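/- Let $\mathscr{T}$ be an infinite rooted tree all of whose vertices have degree at most $D+1$, where $D\in\{1,2,\ldots\}$. For $n\in\mathbb{N}$ let $\mathscr{T}_n$ be the sub-tree consisting of all vertices of $\mathscr{T}$ at graph distance at most $n$ from the root, and let $|\mathscr{T}_n|$ be its number of edges. Fix $p\in(0,1)$ and let $(X_e)$, indexed by the edges $e$ of $\mathscr{T}$, be independent random variables with $P(X_e=+1)=p$ and $P(X_e=-1)=1-p$. Let $\mathscr{T}(p)$ be the random graph obtained from $\mathscr{T}$ by removing all edges $e$ with $X_e=-1$, let $\mathscr{T}_n(p)$ be its restriction to the vertices of $\mathscr{T}_n$, and let $C_n(p)$ be the number of connected components of $\mathscr{T}_n(p)$ that contain at least one edge (isolated vertices are not counted). Put $$H_n(p)=\frac{C_n(p)-\mathbb{E}[C_n(p)]}{\sqrt{\operatorname{Var}[C_n(p)]}},$$ let $N$ be a standard Gaussian random variable, and let $d_K(F,N)=\sup_{x\in\mathbb{R}}|P(F\le x)-P(N\le x)|$ denote the Kolmogorov distance. Then, as $n\to\infty$, $$d_K(H_n(p),N)=\mathcal{O}\big(|\mathscr{T}_n|^{-1/2}\big).$$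 In particular, if $\mathscr{T}$ is a $D$-regular tree, that is, if the root has degree $D$ and every other vertex has degree $D+1$, then $$d_K(H_n(p),N)=\begin{cases}\mathcal{O}(n^{-1/2})&\text{if }D=1,\\ \mathcal{O}(D^{-n/2})&\text{if }D\ge 2.\end{cases}$$ Here $a_n=\mathcal{O}(b_n)$ for non-negative sequences means that there is a constant $c\in(0,\infty)$ with $a_n\le c\,b_n$ for all sufficiently large $n$; the tree and $p$ are fixed. -/

import Mathlib

open MeasureTheory ProbabilityTheory Filter Asymptotics

/-- The set of vertices of the graph `G` with graph distance at most `n` from the root `r`. -/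
def depthBall {V : Type*} (G : SimpleGraph V) (r : V) (n : ℕ) : Set V :=
  {v | G.dist r v ≤ n}

/-- The sub-tree `T_n` of the tree `G` rooted at `r`, spanned by the vertices of depth at
most `n`. -/
def depthSubtree {V : Type*} (G : SimpleGraph V) (r : V) (n : ℕ) :
    SimpleGraph (depthBall G r n) :=
  G.induce (depthBall G r n)

/-- `|T_n|`, the number of edges of `T_n`. -/
noncomputable def numEdges {V : Type*} (G : SimpleGraph V) (r : V) (n : ℕ) : ℕ :=
  (depthSubtree G r n).edgeSet.ncard

/-- Every vertex has degree at most `D + 1` (in particular every degree is finite). -/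
def DegreesBoundedBy {V : Type*} (G : SimpleGraph V) (D : ℕ) : Prop :=
  ∀ v, (G.neighborSet v).encard ≤ D + 1

/-- The root `r` has degree `D` and every other vertex has degree `D + 1`. -/
def IsRegularRooted {V : Type*} (G : SimpleGraph V) (r : V) (D : ℕ) : Prop :=
  (G.neighborSet r).encard = D ∧ ∀ v, v ≠ r → (G.neighborSet v).encard = D + 1

/-- Independent Rademacher variables with success probability `p`, indexed by the edges of `G`. -/
structure IsRademacherEdgeFamily {V Ω : Type*} [MeasurableSpace Ω] (G : SimpleGraph V)
    (X : G.edgeSet → Ω → ℝ) (p : ℝ) (P : Measure Ω) : Prop where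
  measurable : ∀ e, Measurable (X e)
  indep : iIndepFun X P
  prob_one : ∀ e, P.real {ω | X e ω = 1} = p
  prob_neg_one : ∀ e, P.real {ω | X e ω = -1} = 1 - p

/-- The percolated graph: all edges `e` of `G` with `x e = -1` are removed. -/
def percolated {V : Type*} (G : SimpleGraph V) (x : G.edgeSet → ℝ) : SimpleGraph V :=
  G.deleteEdges {e | ∃ h : e ∈ G.edgeSet, x ⟨e, h⟩ = -1}

/-- The number of connected components of `H` that contain at least one edge. -/
noncomputable def numEdgeComponents {V : Type*} (H : SimpleGraph V) : ℕ :=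
  {c : H.ConnectedComponent | ∃ u v, H.Adj u v ∧ H.connectedComponentMk u = c}.ncard

/-- `C_n(p)`: the number of connected components with at least one edge of the restriction of the
percolated graph to the vertices of depth at most `n`. -/
noncomputable def componentCount {V Ω : Type*} (G : SimpleGraph V) (r : V)
    (X : G.edgeSet → Ω → ℝ) (n : ℕ) (ω : Ω) : ℝ :=
  (numEdgeComponents ((percolated G fun e => X e ω).induce (depthBall G r n)) : ℝ)

/-- The centred and normalized random variable `(F - E[F]) / √Var[F]`. -/
noncomputable def normalized {Ω : Type*} [MeasurableSpace Ω] (F : Ω → ℝ) (P : Measure Ω)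
    (ω : Ω) : ℝ :=
  (F ω - ∫ ω', F ω' ∂P) / Real.sqrt (variance F P)

/-- The Kolmogorov distance `sup_x |P(F ≤ x) - Q(N ≤ x)|` of two real random variables, possibly
living on different probability spaces. -/
noncomputable def kolmogorovDist {Ω Ω' : Type*} [MeasurableSpace Ω] [MeasurableSpace Ω']
    (F : Ω → ℝ) (P : Measure Ω) (N : Ω' → ℝ) (Q : Measure Ω') : ℝ :=
  ⨆ x : ℝ, |P.real {ω | F ω ≤ x} - Q.real {ω | N ω ≤ x}|

/-! ### The Stein equation of the Kolmogorov distance -/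

section Stein

open Set Real Topology

/-- The distribution function of the standard Gaussian. -/
noncomputable def stdCdf (w : ℝ) : ℝ := (gaussianReal 0 1).real (Iic w)

/-- The density of the standard Gaussian. -/
noncomputable def stdPdf (w : ℝ) : ℝ := gaussianPDFReal 0 1 w

lemma stdPdf_eq (w : ℝ) : stdPdf w = (√(2 * π))⁻¹ * rexp (-w ^ 2 / 2) := by
  simp [stdPdf, gaussianPDFReal]

lemma stdPdf_pos (w : ℝ) : 0 < stdPdf w := gaussianPDFReal_pos _ _ _ (by simp)

lemma stdPdf_neg (w : ℝ) : stdPdf (-w) = stdPdf w := by simp [stdPdf_eq]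

lemma hasDerivAt_stdPdf (w : ℝ) : HasDerivAt stdPdf (-w * stdPdf w) w := by
  have h : HasDerivAt (fun w : ℝ => (√(2 * π))⁻¹ * rexp (-w ^ 2 / 2))
      ((√(2 * π))⁻¹ * (rexp (-w ^ 2 / 2) * (-(2 * w) / 2))) w := by
    have := ((((hasDerivAt_id w).pow 2).neg.div_const 2).exp).const_mul (√(2 * π))⁻¹
    simpa using this
  rw [show stdPdf = fun w : ℝ => (√(2 * π))⁻¹ * rexp (-w ^ 2 / 2) from funext stdPdf_eq]
  convert h using 1
  ring

lemma continuous_stdPdf : Continuous stdPdf :=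
  continuous_iff_continuousAt.2 fun w => (hasDerivAt_stdPdf w).continuousAt

lemma stdCdf_eq_integral (w : ℝ) : stdCdf w = ∫ t in Iic w, stdPdf t := by
  rw [stdCdf, measureReal_def, gaussianReal_apply_eq_integral 0 one_ne_zero,
    ENNReal.toReal_ofReal (integral_nonneg fun t => gaussianPDFReal_nonneg _ _ _)]
  rfl

lemma integrable_stdPdf : Integrable stdPdf := integrable_gaussianPDFReal 0 1

lemma hasDerivAt_stdCdf (w : ℝ) : HasDerivAt stdCdf (stdPdf w) w := by
  have h : stdCdf = fun w => stdCdf 0 + ∫ t in (0 : ℝ)..w, stdPdf t := by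
    funext w
    rw [← intervalIntegral.integral_Iic_sub_Iic integrable_stdPdf.integrableOn
      integrable_stdPdf.integrableOn, ← stdCdf_eq_integral, ← stdCdf_eq_integral]
    ring
  rw [h]
  exact (intervalIntegral.integral_hasDerivAt_right
    (continuous_stdPdf.intervalIntegrable _ _)
    continuous_stdPdf.stronglyMeasurable.stronglyMeasurableAtFilter
    continuous_stdPdf.continuousAt).const_add _

lemma stdCdf_nonneg (w : ℝ) : 0 ≤ stdCdf w := measureReal_nonneg

lemma stdCdf_le_one (w : ℝ) : stdCdf w ≤ 1 := measureReal_le_one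

lemma stdCdf_neg (w : ℝ) : stdCdf (-w) = 1 - stdCdf w := by
  have h1 : (gaussianReal 0 1).map (fun x => -x) = gaussianReal 0 1 := by
    simpa using gaussianReal_map_neg (μ := 0) (v := 1)
  have h2 : stdCdf (-w) = (gaussianReal 0 1).real (Ici w) := by
    rw [stdCdf, measureReal_def, ← h1, Measure.map_apply measurable_neg measurableSet_Iic,
      h1, measureReal_def]
    congr 2
    ext y
    simp
  have : NullSingletonClass (gaussianReal 0 1) := nullSingletonClass_gaussianReal one_ne_zero
  rw [h2, measureReal_def, ← measure_congr Ioi_ae_eq_Ici, ← measureReal_def, ← compl_Iic,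
    probReal_compl_eq_one_sub measurableSet_Iic, stdCdf]

lemma tendsto_stdCdf_atBot : Tendsto stdCdf atBot (𝓝 0) := by
  have h := tendsto_cdf_atBot (gaussianReal 0 1)
  have h2 : stdCdf = cdf (gaussianReal 0 1) := by
    funext w
    rw [cdf_eq_real, stdCdf]
  rwa [h2]

lemma tendsto_stdPdf_atBot : Tendsto stdPdf atBot (𝓝 0) := by
  rw [show stdPdf = fun w : ℝ => (√(2 * π))⁻¹ * rexp (-w ^ 2 / 2) from funext stdPdf_eq]
  have h : Tendsto (fun w : ℝ => w ^ 2 / 2) atBot atTop := by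
    have h' : Tendsto (fun w : ℝ => w ^ 2) atBot atTop := by
      simpa [Function.comp_def] using
        (tendsto_pow_atTop two_ne_zero).comp (tendsto_neg_atBot_atTop (G := ℝ))
    exact h'.atTop_div_const (by norm_num)
  have := (Real.tendsto_exp_neg_atTop_nhds_zero.comp h).const_mul (√(2 * π))⁻¹
  simpa [Function.comp_def, neg_div] using this

/-- The ratio of the distribution function and the density of the standard Gaussian. -/
noncomputable def millsRatio (w : ℝ) : ℝ := stdCdf w / stdPdf w

lemma millsRatio_nonneg (w : ℝ) : 0 ≤ millsRatio w :=
  div_nonneg (stdCdf_nonneg w) (stdPdf_pos w).le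

lemma hasDerivAt_millsRatio (w : ℝ) : HasDerivAt millsRatio (w * millsRatio w + 1) w := by
  have h := (hasDerivAt_stdCdf w).div (hasDerivAt_stdPdf w) (stdPdf_pos w).ne'
  have := (stdPdf_pos w).ne'
  refine h.congr_deriv ?_
  rw [millsRatio]
  field_simp
  ring

lemma neg_div_mul_stdPdf_le_stdCdf (w : ℝ) : -(w / (1 + w ^ 2)) * stdPdf w ≤ stdCdf w := by
  have hd : ∀ w : ℝ, HasDerivAt (fun w => stdCdf w + w / (1 + w ^ 2) * stdPdf w)
      (2 / (1 + w ^ 2) ^ 2 * stdPdf w) w := by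
    intro w
    have h0 : (1 + w ^ 2) ≠ 0 := by positivity
    have h1 : HasDerivAt (fun w : ℝ => 1 + w ^ 2) (2 * w) w := by
      simpa using ((hasDerivAt_id w).pow 2).const_add 1
    have h := (hasDerivAt_stdCdf w).add
      (((hasDerivAt_id w).div h1 h0).mul (hasDerivAt_stdPdf w))
    refine h.congr_deriv ?_
    simp only [id, Pi.div_apply]
    field_simp
    ring
  have hm : Monotone (fun w => stdCdf w + w / (1 + w ^ 2) * stdPdf w) :=
    monotone_of_hasDerivAt_nonneg hd fun w => by
      have := stdPdf_pos w
      simp only [Pi.zero_apply]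
      positivity
  have ht : Tendsto (fun w => stdCdf w + w / (1 + w ^ 2) * stdPdf w) atBot (𝓝 0) := by
    have hb : Tendsto (fun w => w / (1 + w ^ 2) * stdPdf w) atBot (𝓝 0) := by
      refine squeeze_zero_norm (fun w => ?_) tendsto_stdPdf_atBot
      rw [norm_mul, Real.norm_of_nonneg (stdPdf_pos w).le]
      refine mul_le_of_le_one_left (stdPdf_pos w).le ?_
      rw [Real.norm_eq_abs, abs_div, abs_of_pos (show 0 < 1 + w ^ 2 by positivity),
        div_le_one (by positivity), abs_le]
      constructor <;> nlinarith [sq_nonneg (w + 1), sq_nonneg (w - 1)]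
    simpa using tendsto_stdCdf_atBot.add hb
  have := hm.le_of_tendsto ht w
  linarith

lemma stdCdf_le_div_mul_stdPdf {w : ℝ} (hw : w < 0) : stdCdf w ≤ -(w⁻¹) * stdPdf w := by
  have hd : ∀ w : ℝ, w < 0 → HasDerivAt (fun w => -(w⁻¹) * stdPdf w - stdCdf w)
      (stdPdf w / w ^ 2) w := by
    intro w hw
    have h := (((hasDerivAt_inv hw.ne).neg).mul (hasDerivAt_stdPdf w)).sub (hasDerivAt_stdCdf w)
    refine h.congr_deriv ?_
    have := hw.ne
    simp only [Pi.neg_apply]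
    field_simp
    ring
  have hm : MonotoneOn (fun w => -(w⁻¹) * stdPdf w - stdCdf w) (Iio 0) := by
    refine monotoneOn_of_hasDerivWithinAt_nonneg (convex_Iio 0)
      (fun w hw => (hd w hw).continuousAt.continuousWithinAt) (f' := fun w => stdPdf w / w ^ 2)
      (fun w hw => ?_) (fun w hw => ?_)
    · exact (hd w (by simpa using hw)).hasDerivWithinAt
    · exact div_nonneg (stdPdf_pos w).le (sq_nonneg w)
  have ht : Tendsto (fun w => -(w⁻¹) * stdPdf w - stdCdf w) atBot (𝓝 0) := by
    simpa using ((tendsto_inv_atBot_zero (𝕜 := ℝ)).neg.mul tendsto_stdPdf_atBot).sub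
      tendsto_stdCdf_atBot
  have h0 : 0 ≤ -(w⁻¹) * stdPdf w - stdCdf w := by
    refine le_of_tendsto ht ?_
    filter_upwards [eventually_le_atBot w] with v hv
    exact hm (hv.trans_lt hw) hw hv
  linarith

lemma neg_one_le_mul_millsRatio (w : ℝ) : -1 ≤ w * millsRatio w := by
  rcases le_or_gt 0 w with hw | hw
  · have := mul_nonneg hw (millsRatio_nonneg w)
    linarith
  · have h := stdCdf_le_div_mul_stdPdf hw
    have hp := stdPdf_pos w
    have h2 : millsRatio w ≤ -w⁻¹ := by rwa [millsRatio, div_le_iff₀ hp]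
    have h3 := mul_le_mul_of_nonpos_left h2 hw.le
    have : w * -w⁻¹ = -1 := by
      rw [mul_neg, mul_inv_cancel₀ hw.ne]
    linarith

lemma monotone_mul_millsRatio : Monotone fun w => w * millsRatio w := by
  refine monotone_of_hasDerivAt_nonneg
    (f' := fun w => (1 + w ^ 2) * millsRatio w + w) (fun w => ?_) (fun w => ?_)
  · refine ((hasDerivAt_id w).mul (hasDerivAt_millsRatio w)).congr_deriv ?_
    simp only [id]
    ring
  · have h := neg_div_mul_stdPdf_le_stdCdf w
    rw [← le_div_iff₀ (stdPdf_pos w), ← millsRatio] at h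
    have h1 : (0 : ℝ) < 1 + w ^ 2 := by positivity
    have h2 := mul_le_mul_of_nonneg_left h h1.le
    have h3 : (1 + w ^ 2) * -(w / (1 + w ^ 2)) = -w := by field_simp
    simp only [Pi.zero_apply]
    linarith

/-- The solution of the Stein equation `f' w - w f w = 1_{w ≤ x} - P(N ≤ x)`. -/
noncomputable def steinSol (x w : ℝ) : ℝ :=
  if w ≤ x then (1 - stdCdf x) * millsRatio w else stdCdf x * millsRatio (-w)

lemma steinSol_of_le {x w : ℝ} (h : w ≤ x) : steinSol x w = (1 - stdCdf x) * millsRatio w :=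
  if_pos h

lemma steinSol_of_ge {x w : ℝ} (h : x ≤ w) : steinSol x w = stdCdf x * millsRatio (-w) := by
  rcases h.eq_or_lt with rfl | h
  · rw [steinSol_of_le le_rfl, millsRatio, millsRatio, stdCdf_neg, stdPdf_neg]
    ring
  · exact if_neg h.not_ge

lemma monotone_mul_steinSol (x : ℝ) : Monotone fun w => w * steinSol x w := by
  have h1 : MonotoneOn (fun w => w * steinSol x w) (Iic x) := by
    intro a ha b hb hab
    simp only [steinSol_of_le ha, steinSol_of_le hb]
    have := mul_le_mul_of_nonneg_left (monotone_mul_millsRatio hab)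
      (sub_nonneg.2 (stdCdf_le_one x))
    simp only at this
    linarith
  have h2 : MonotoneOn (fun w => w * steinSol x w) (Ici x) := by
    intro a ha b hb hab
    simp only [steinSol_of_ge ha, steinSol_of_ge hb]
    have := mul_le_mul_of_nonneg_left (monotone_mul_millsRatio (neg_le_neg hab))
      (stdCdf_nonneg x)
    simp only at this
    linarith
  exact h1.Iic_union_Ici h2

lemma steinSol_bounds_of_le {x w : ℝ} (h : w ≤ x) :
    -(1 - stdCdf x) ≤ w * steinSol x w ∧ w * steinSol x w ≤ stdCdf x := by
  have h0 := stdCdf_nonneg x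
  have h1 := sub_nonneg.2 (stdCdf_le_one x)
  constructor
  · rw [steinSol_of_le h]
    nlinarith [neg_one_le_mul_millsRatio w]
  · refine (monotone_mul_steinSol x h).trans ?_
    simp only [steinSol_of_ge (le_refl x)]
    nlinarith [neg_one_le_mul_millsRatio (-x)]

lemma steinSol_bounds_of_ge {x w : ℝ} (h : x ≤ w) :
    -(1 - stdCdf x) ≤ w * steinSol x w ∧ w * steinSol x w ≤ stdCdf x := by
  have h0 := stdCdf_nonneg x
  have h1 := sub_nonneg.2 (stdCdf_le_one x)
  constructor
  · exact (steinSol_bounds_of_le le_rfl).1.trans (monotone_mul_steinSol x h)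
  · rw [steinSol_of_ge h]
    nlinarith [neg_one_le_mul_millsRatio (-w)]

lemma mul_steinSol_bounds (x w : ℝ) :
    -(1 - stdCdf x) ≤ w * steinSol x w ∧ w * steinSol x w ≤ stdCdf x :=
  (le_total w x).elim steinSol_bounds_of_le steinSol_bounds_of_ge

/-- The increments of the Stein solution are controlled by the values at the end points of the
two monotone parts of its derivative. -/
lemma steinSol_sub_bounds (x : ℝ) {a b : ℝ} (hab : a ≤ b) :
    (b - a) * (a * steinSol x a + (if b ≤ x then 1 else 0) - stdCdf x)
        ≤ steinSol x b - steinSol x a ∧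
      steinSol x b - steinSol x a
        ≤ (b - a) * (b * steinSol x b + (if a ≤ x then 1 else 0) - stdCdf x) := by
  have key1 : ∀ a b : ℝ, a ≤ b → b ≤ x →
      (b - a) * (a * steinSol x a + 1 - stdCdf x) ≤ steinSol x b - steinSol x a ∧
      steinSol x b - steinSol x a ≤ (b - a) * (b * steinSol x b + 1 - stdCdf x) := by
    intro a b hab hb
    rcases hab.eq_or_lt with rfl | hlt
    · simp
    obtain ⟨c, hc, hc'⟩ := exists_hasDerivAt_eq_slope
      (fun w => (1 - stdCdf x) * millsRatio w) (fun w => (1 - stdCdf x) * (w * millsRatio w + 1))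
      hlt (fun w _ => ((hasDerivAt_millsRatio w).const_mul _).continuousAt.continuousWithinAt)
      (fun w _ => (hasDerivAt_millsRatio w).const_mul _)
    rw [eq_div_iff (sub_pos.2 hlt).ne', ← steinSol_of_le hb, ← steinSol_of_le (hab.trans hb)] at hc'
    have hcx := steinSol_of_le (hc.2.le.trans hb)
    have e : (1 - stdCdf x) * (c * millsRatio c + 1) = c * steinSol x c + 1 - stdCdf x := by
      rw [hcx]; ring
    have m1 := monotone_mul_steinSol x hc.1.le
    have m2 := monotone_mul_steinSol x hc.2.le
    simp only at m1 m2
    rw [← hc', e, mul_comm _ (b - a)]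
    constructor <;> exact mul_le_mul_of_nonneg_left (by linarith) (sub_nonneg.2 hab)
  have key2 : ∀ a b : ℝ, a ≤ b → x ≤ a →
      (b - a) * (a * steinSol x a - stdCdf x) ≤ steinSol x b - steinSol x a ∧
      steinSol x b - steinSol x a ≤ (b - a) * (b * steinSol x b - stdCdf x) := by
    intro a b hab hb
    rcases hab.eq_or_lt with rfl | hlt
    · simp
    have hd : ∀ w, HasDerivAt (fun w => stdCdf x * millsRatio (-w))
        (stdCdf x * (-w * millsRatio (-w) + 1) * (-1)) w := fun w => by
      have := ((hasDerivAt_millsRatio (-w)).comp w (hasDerivAt_neg w)).const_mul (stdCdf x)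
      exact this.congr_deriv (by ring)
    obtain ⟨c, hc, hc'⟩ := exists_hasDerivAt_eq_slope
      (fun w => stdCdf x * millsRatio (-w)) (fun w => stdCdf x * (-w * millsRatio (-w) + 1) * (-1))
      hlt (fun w _ => (hd w).continuousAt.continuousWithinAt) (fun w _ => hd w)
    rw [eq_div_iff (sub_pos.2 hlt).ne', ← steinSol_of_ge hb, ← steinSol_of_ge (hb.trans hab)] at hc'
    have hcx := steinSol_of_ge (hb.trans hc.1.le)
    have e : stdCdf x * (-c * millsRatio (-c) + 1) * (-1) = c * steinSol x c - stdCdf x := by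
      rw [hcx]; ring
    have m1 := monotone_mul_steinSol x hc.1.le
    have m2 := monotone_mul_steinSol x hc.2.le
    simp only at m1 m2
    rw [← hc', e, mul_comm _ (b - a)]
    constructor <;> exact mul_le_mul_of_nonneg_left (by linarith) (sub_nonneg.2 hab)
  rcases le_or_gt b x with hb | hb
  · simpa [hb, hab.trans hb] using key1 a b hab hb
  rcases lt_or_ge x a with ha | ha
  · simpa [hb.not_ge, ha.not_ge] using key2 a b hab ha.le
  obtain ⟨l1, u1⟩ := key1 a x ha le_rfl
  obtain ⟨l2, u2⟩ := key2 x b hb.le le_rfl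
  have m1 := monotone_mul_steinSol x ha
  have m2 := monotone_mul_steinSol x hb.le
  simp only [if_neg hb.not_ge, if_pos ha] at m1 m2 ⊢
  constructor
  · nlinarith [mul_nonneg (sub_nonneg.2 hb.le) (sub_nonneg.2 m1)]
  · nlinarith [mul_nonneg (sub_nonneg.2 ha) (sub_nonneg.2 m2)]

end Stein

/-! ### Stein's method for sums with local swaps -/

section Swap

variable {Ω : Type*} [Finite Ω] [MeasurableSpace Ω] [MeasurableSingletonClass Ω]

lemma integrable_of_finite_domain (μ : Measure Ω) [IsFiniteMeasure μ] (f : Ω → ℝ) :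
    Integrable f μ := Integrable.of_finite

lemma MeasureTheory.MeasurePreserving.integral_comp_of_finite {μ : Measure Ω} {S : Ω → Ω}
    (hS : MeasurePreserving S μ μ) (f : Ω → ℝ) : ∫ ω, f (S ω) ∂μ = ∫ ω, f ω ∂μ := by
  conv_rhs => rw [← hS.map_eq]
  rw [integral_map hS.measurable.aemeasurable]
  exact (measurable_of_finite f).aestronglyMeasurable

/-- The remainder in the first order expansion of the Stein solution is dominated by the increment
of a bounded monotone function. -/
lemma abs_steinSol_sub_le (x v w : ℝ) :
    |steinSol x w - steinSol x v -
        (w - v) * (w * steinSol x w + (if w ≤ x then 1 else 0) - stdCdf x)| ≤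
      (w - v) * ((w * steinSol x w - if w ≤ x then 1 else 0) -
        (v * steinSol x v - if v ≤ x then 1 else 0)) := by
  rcases le_total v w with h | h
  · obtain ⟨h1, h2⟩ := steinSol_sub_bounds x h
    have m := monotone_mul_steinSol x h
    have i : (if w ≤ x then (1 : ℝ) else 0) ≤ if v ≤ x then 1 else 0 := by
      split_ifs <;> linarith
    simp only at m
    have p1 := mul_nonneg (sub_nonneg.2 h) (sub_nonneg.2 m)
    have p2 := mul_nonneg (sub_nonneg.2 h) (sub_nonneg.2 i)
    rw [abs_le]
    constructor <;> nlinarith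
  · obtain ⟨h1, h2⟩ := steinSol_sub_bounds x h
    have m := monotone_mul_steinSol x h
    have i : (if v ≤ x then (1 : ℝ) else 0) ≤ if w ≤ x then 1 else 0 := by
      split_ifs <;> linarith
    simp only at m
    have p1 := mul_nonneg (sub_nonneg.2 h) (sub_nonneg.2 m)
    have p2 := mul_nonneg (sub_nonneg.2 h) (sub_nonneg.2 i)
    rw [abs_le]
    constructor <;> nlinarith

lemma abs_mul_steinSol_sub_ite_le (x w : ℝ) :
    |w * steinSol x w - if w ≤ x then 1 else 0| ≤ 2 := by
  have h := mul_steinSol_bounds x w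
  have h0 := stdCdf_nonneg x
  have h1 := stdCdf_le_one x
  rw [abs_le]
  split_ifs <;> constructor <;> linarith [h.1, h.2]

lemma abs_mul_steinSol_add_ite_sub_le (x w : ℝ) :
    |w * steinSol x w + (if w ≤ x then 1 else 0) - stdCdf x| ≤ 1 := by
  have h0 := stdCdf_nonneg x
  have h1 := stdCdf_le_one x
  have h := mul_steinSol_bounds x w
  rw [abs_le]
  split_ifs <;> constructor <;> linarith [h.1, h.2]

/-- A Kolmogorov bound for a sum `W = ∑ η j`, where each `η j` comes with a measure preserving
involution which makes it independent of `W`. -/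
theorem abs_measureReal_le_sub_stdCdf_le (μ : Measure Ω) [IsProbabilityMeasure μ] {κ : Type*}
    [Fintype κ] (η : κ → Ω → ℝ) (S : κ → Ω → Ω) (W : Ω → ℝ) (hW : ∀ ω, W ω = ∑ j, η j ω)
    (hS : ∀ j, MeasurePreserving (S j) μ μ) (hinv : ∀ j, Function.Involutive (S j))
    (hind : ∀ j (h : ℝ → ℝ), ∫ ω, η j (S j ω) * h (W ω) ∂μ = 0) (x : ℝ) :
    |μ.real {ω | W ω ≤ x} - stdCdf x| ≤
      (∫ ω, |1 - 1 / 2 * ∑ j, (η j ω - η j (S j ω)) * (W ω - W (S j ω))| ∂μ) +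
      2 * ∫ ω, |∑ j, |η j ω - η j (S j ω)| * (W ω - W (S j ω))| ∂μ := by
  have int := integrable_of_finite_domain μ
  set f := steinSol x
  set D : κ → Ω → ℝ := fun j ω => η j ω - η j (S j ω) with hD
  set Δ : κ → Ω → ℝ := fun j ω => W ω - W (S j ω) with hΔ
  have hDS : ∀ j ω, D j (S j ω) = -D j ω := fun j ω => by simp [hD, hinv j ω]
  have hΔS : ∀ j ω, Δ j (S j ω) = -Δ j ω := fun j ω => by simp [hΔ, hinv j ω]
  set q' : ℝ → ℝ := fun w => w * f w + (if w ≤ x then 1 else 0) - stdCdf x with hq'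
  set q : ℝ → ℝ := fun w => w * f w - (if w ≤ x then 1 else 0) with hq
  have e1 : 2 * ∫ ω, W ω * f (W ω) ∂μ =
      ∑ j, ∫ ω, D j ω * (f (W ω) - f (W (S j ω))) ∂μ := by
    have a1 : ∫ ω, W ω * f (W ω) ∂μ = ∑ j, ∫ ω, η j ω * f (W ω) ∂μ := by
      rw [← integral_finsetSum _ fun j _ => int _]
      refine integral_congr_ae (.of_forall fun ω => ?_)
      simp only
      rw [← Finset.sum_mul, ← hW]
    rw [a1, Finset.mul_sum]
    refine Finset.sum_congr rfl fun j _ => ?_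
    have a2 : ∫ ω, D j ω * f (W ω) ∂μ = ∫ ω, η j ω * f (W ω) ∂μ := by
      simp only [hD, sub_mul]
      rw [integral_sub (int _) (int _), hind j f, sub_zero]
    have a3 : ∫ ω, D j ω * f (W (S j ω)) ∂μ = -∫ ω, D j ω * f (W ω) ∂μ := by
      rw [← (hS j).integral_comp_of_finite, ← integral_neg]
      refine integral_congr_ae (.of_forall fun ω => ?_)
      simp only
      rw [hDS, hinv j ω, neg_mul]
    simp only [mul_sub]
    rw [integral_sub (int _) (int _), a3, a2]
    ring
  have e2 : |2 * (∫ ω, W ω * f (W ω) ∂μ) - ∫ ω, (∑ j, D j ω * Δ j ω) * q' (W ω) ∂μ| ≤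
      4 * ∫ ω, |∑ j, |D j ω| * Δ j ω| ∂μ := by
    have b1 : ∫ ω, (∑ j, D j ω * Δ j ω) * q' (W ω) ∂μ =
        ∑ j, ∫ ω, D j ω * (Δ j ω * q' (W ω)) ∂μ := by
      rw [← integral_finsetSum _ fun j _ => int _]
      simp only [Finset.sum_mul, mul_assoc]
    have b2 : ∀ j, |(∫ ω, D j ω * (f (W ω) - f (W (S j ω))) ∂μ) -
        ∫ ω, D j ω * (Δ j ω * q' (W ω)) ∂μ| ≤ 2 * ∫ ω, |D j ω| * Δ j ω * q (W ω) ∂μ := by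
      intro j
      rw [← integral_sub (int _) (int _)]
      have b3 : 2 * ∫ ω, |D j ω| * Δ j ω * q (W ω) ∂μ =
          ∫ ω, |D j ω| * (Δ j ω * (q (W ω) - q (W (S j ω)))) ∂μ := by
        have b4 : ∫ ω, |D j ω| * Δ j ω * q (W (S j ω)) ∂μ =
            -∫ ω, |D j ω| * Δ j ω * q (W ω) ∂μ := by
          rw [← (hS j).integral_comp_of_finite, ← integral_neg]
          refine integral_congr_ae (.of_forall fun ω => ?_)
          simp only
          rw [hDS, hΔS, hinv j ω, abs_neg]
          ring
        simp only [← mul_assoc, mul_sub]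
        rw [integral_sub (int _) (int _), b4]
        ring
      rw [b3]
      refine (abs_integral_le_integral_abs).trans (integral_mono (int _) (int _) fun ω => ?_)
      simp only
      rw [← mul_sub, abs_mul]
      exact mul_le_mul_of_nonneg_left (abs_steinSol_sub_le x _ _) (abs_nonneg _)
    rw [e1, b1, ← Finset.sum_sub_distrib]
    calc _ ≤ ∑ j, 2 * ∫ ω, |D j ω| * Δ j ω * q (W ω) ∂μ :=
          (Finset.abs_sum_le_sum_abs _ _).trans (Finset.sum_le_sum fun j _ => b2 j)
      _ = 2 * ∫ ω, (∑ j, |D j ω| * Δ j ω) * q (W ω) ∂μ := by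
          rw [← Finset.mul_sum, ← integral_finsetSum _ fun j _ => int _]
          simp only [Finset.sum_mul]
      _ ≤ 2 * ∫ ω, |∑ j, |D j ω| * Δ j ω| * 2 ∂μ := by
          gcongr 2 * ?_
          refine integral_mono (int _) (int _) fun ω => (le_abs_self _).trans ?_
          simp only
          rw [abs_mul]
          exact mul_le_mul_of_nonneg_left (abs_mul_steinSol_sub_ite_le x _) (abs_nonneg _)
      _ = _ := by rw [integral_mul_const]; ring
  have e3 : μ.real {ω | W ω ≤ x} - stdCdf x =
      (∫ ω, q' (W ω) ∂μ) - ∫ ω, W ω * f (W ω) ∂μ := by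
    have c1 : μ.real {ω | W ω ≤ x} = ∫ ω, (if W ω ≤ x then (1 : ℝ) else 0) ∂μ := by
      rw [← integral_indicator_one (Set.toFinite _).measurableSet]
      rfl
    simp only [hq']
    rw [integral_sub (int _) (int _), integral_add (int _) (int _), ← c1]
    simp
    ring
  have e4 : |∫ ω, q' (W ω) * (1 - 1 / 2 * ∑ j, D j ω * Δ j ω) ∂μ| ≤
      ∫ ω, |1 - 1 / 2 * ∑ j, D j ω * Δ j ω| ∂μ := by
    refine (abs_integral_le_integral_abs).trans (integral_mono (int _) (int _) fun ω => ?_)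
    simp only
    rw [abs_mul]
    exact mul_le_of_le_one_left (abs_nonneg _) (abs_mul_steinSol_add_ite_sub_le x _)
  have e5 : ∫ ω, q' (W ω) * (1 - 1 / 2 * ∑ j, D j ω * Δ j ω) ∂μ =
      (∫ ω, q' (W ω) ∂μ) - 1 / 2 * ∫ ω, (∑ j, D j ω * Δ j ω) * q' (W ω) ∂μ := by
    rw [← integral_const_mul, ← integral_sub (int _) (int _)]
    refine integral_congr_ae (.of_forall fun ω => ?_)
    simp only
    ring
  rw [e3]
  rw [e5] at e4
  rw [abs_le] at *
  constructor <;> linarith [e2.1, e2.2, e4.1, e4.2]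

end Swap

/-! ### Local dependence on finite product spaces -/

section Product

open Finset

lemma measurePreserving_pi_comp_equiv {α τ : Type*} [MeasurableSpace α] [Fintype τ]
    (ν : τ → Measure α) [∀ i, IsProbabilityMeasure (ν i)] (σ : τ ≃ τ) (hσ : ∀ i, ν (σ i) = ν i) :
    MeasurePreserving (fun (x : τ → α) i => x (σ i)) (Measure.pi ν) (Measure.pi ν) := by
  have h := measurePreserving_piCongrLeft (α := fun _ => α) ν σ.symm
  have e : (fun i => ν (σ.symm i)) = ν := by
    funext i
    rw [← hσ (σ.symm i), σ.apply_symm_apply]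
  rw [e] at h
  convert h using 1
  funext x i
  obtain ⟨j, rfl⟩ := σ.symm.surjective i
  rw [MeasurableEquiv.piCongrLeft_apply_apply, σ.apply_symm_apply]

lemma card_filter_not_disjoint_le {τ κ : Type*} [Fintype κ] [DecidableEq τ] (A : κ → Finset τ)
    {a b : ℕ} (ha : ∀ j, #(A j) ≤ a) (hb : ∀ e, #{j | e ∈ A j} ≤ b) (j : κ) :
    #{k | ¬Disjoint (A j) (A k)} ≤ a * b := by
  classical
  calc #{k | ¬Disjoint (A j) (A k)} ≤ #((A j).biUnion fun e => {k | e ∈ A k}) := by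
        refine card_le_card fun k hk => ?_
        simp only [mem_filter, mem_univ, true_and, not_disjoint_iff] at hk
        simpa using hk
    _ ≤ #(A j) * b := card_biUnion_le_card_mul _ _ _ fun e _ => hb e
    _ ≤ a * b := Nat.mul_le_mul_right _ (ha j)

variable {α : Type*} [Finite α] [MeasurableSpace α] [MeasurableSingletonClass α]
variable {τ : Type*} [Fintype τ] (ν : τ → Measure α) [∀ i, IsProbabilityMeasure (ν i)]

lemma memLp_of_finite_domain {Ω : Type*} [Finite Ω] [MeasurableSpace Ω]
    [MeasurableSingletonClass Ω] (μ : Measure Ω) [IsFiniteMeasure μ] (f : Ω → ℝ) :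
    MemLp f 2 μ :=
  (memLp_two_iff_integrable_sq (measurable_of_finite f).aestronglyMeasurable).2
    (integrable_of_finite_domain μ _)

lemma integral_mul_of_dependsOn_disjoint {f g : (τ → α) → ℝ} {A B : Set τ}
    (hf : DependsOn f A) (hg : DependsOn g B) (hAB : Disjoint A B) :
    ∫ x, f x * g x ∂Measure.pi ν = (∫ x, f x ∂Measure.pi ν) * ∫ x, g x ∂Measure.pi ν := by
  classical
  have hf' : DependsOn f (A.toFinset : Set τ) := by simpa using hf
  have hg' : DependsOn g (B.toFinset : Set τ) := by simpa using hg
  obtain ⟨f', rfl⟩ := dependsOn_iff_exists_comp.1 hf'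
  obtain ⟨g', rfl⟩ := dependsOn_iff_exists_comp.1 hg'
  have h := (iIndepFun_pi (μ := ν) (X := fun _ => id) fun _ => aemeasurable_id).indepFun_finset
    A.toFinset B.toFinset (by simpa using hAB) (fun i => measurable_pi_apply i)
  have h2 := h.comp (φ := f') (ψ := g') (measurable_of_finite f') (measurable_of_finite g')
  exact h2.integral_fun_mul_eq_mul_integral (measurable_of_finite _).aestronglyMeasurable
    (measurable_of_finite _).aestronglyMeasurable

lemma measurePreserving_pi_double_fst {ι : Type*} [Fintype ι] (ν : ι → Measure α)
    [∀ i, IsProbabilityMeasure (ν i)] :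
    MeasurePreserving (fun (z : ι × Bool → α) i => z (i, true))
      (Measure.pi fun t : ι × Bool => ν t.1) (Measure.pi ν) := by
  refine ⟨measurable_of_finite _, (Measure.pi_eq fun s hs => ?_).symm⟩
  rw [Measure.map_apply (measurable_of_finite _) (MeasurableSet.univ_pi hs)]
  have : (fun (z : ι × Bool → α) i => z (i, true)) ⁻¹' Set.univ.pi s =
      Set.univ.pi fun t : ι × Bool => if t.2 then s t.1 else Set.univ := by
    ext z
    simp [Set.mem_pi]
  rw [this, Measure.pi_pi, Fintype.prod_prod_type]
  simp

open Classical in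
/-- The variance of a sum of bounded functions of few coordinates grows at most linearly. -/
lemma variance_sum_le_of_dependsOn {κ : Type*} [Fintype κ] (U : κ → (τ → α) → ℝ) (B : κ → Set τ)
    (hU : ∀ j, DependsOn (U j) (B j)) {M : ℝ} (hM : ∀ j x, |U j x| ≤ M) {L : ℕ}
    (hL : ∀ j, #{k | ¬Disjoint (B j) (B k)} ≤ L) :
    variance (fun x => ∑ j, U j x) (Measure.pi ν) ≤ Fintype.card κ * (L * (2 * M ^ 2)) := by
  have hmem := memLp_of_finite_domain (Measure.pi ν)
  have hb : ∀ f : (τ → α) → ℝ, ∀ c, (∀ x, |f x| ≤ c) → |∫ x, f x ∂Measure.pi ν| ≤ c := by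
    intro f c hf
    have := norm_integral_le_of_norm_le_const (μ := Measure.pi ν) (f := f) (C := c)
      (.of_forall fun x => hf x)
    simpa using this
  rw [← covariance_self (measurable_of_finite _).aemeasurable,
    covariance_fun_sum_fun_sum (fun _ => hmem _) (fun _ => hmem _)]
  have hc : ∀ j k, covariance (U j) (U k) (Measure.pi ν) ≤
      if Disjoint (B j) (B k) then 0 else 2 * M ^ 2 := by
    intro j k
    rw [covariance_eq_sub (hmem _) (hmem _)]
    simp only [Pi.mul_apply]
    split_ifs with hd
    · rw [integral_mul_of_dependsOn_disjoint ν (hU j) (hU k) hd, sub_self]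
    · have h1 := hb (fun x => U j x * U k x) (M * M) fun x => by
        rw [abs_mul]
        exact mul_le_mul (hM j x) (hM k x) (abs_nonneg _) ((abs_nonneg _).trans (hM j x))
      have h2 : |(∫ x, U j x ∂Measure.pi ν) * ∫ x, U k x ∂Measure.pi ν| ≤ M * M := by
        rw [abs_mul]
        exact mul_le_mul (hb _ _ (hM j)) (hb _ _ (hM k)) (abs_nonneg _)
          ((abs_nonneg _).trans (hb _ _ (hM j)))
      rw [abs_le] at h1 h2
      nlinarith [h1.2, h2.1]
  calc ∑ j, ∑ k, covariance (U j) (U k) (Measure.pi ν)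
      ≤ ∑ j, ∑ k, if Disjoint (B j) (B k) then 0 else 2 * M ^ 2 :=
        sum_le_sum fun j _ => sum_le_sum fun k _ => hc j k
    _ ≤ ∑ _j : κ, (L : ℝ) * (2 * M ^ 2) := by
        refine sum_le_sum fun j _ => ?_
        rw [sum_ite, sum_const_zero, zero_add, sum_const, nsmul_eq_mul]
        gcongr
        exact_mod_cast hL j
    _ = _ := by simp

lemma integral_abs_sub_le_sqrt_variance {Ω : Type*} [Finite Ω] [MeasurableSpace Ω]
    [MeasurableSingletonClass Ω] (μ : Measure Ω) [IsProbabilityMeasure μ] (V : Ω → ℝ) :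
    ∫ ω, |(∫ ω', V ω' ∂μ) - V ω| ∂μ ≤ √(variance V μ) := by
  refine Real.le_sqrt_of_sq_le ?_
  have h := variance_nonneg (fun ω => |(∫ ω', V ω' ∂μ) - V ω|) μ
  rw [variance_eq_sub (memLp_of_finite_domain μ _)] at h
  rw [variance_eq_integral (measurable_of_finite V).aemeasurable]
  have e : ∫ ω, ((fun ω => |(∫ ω', V ω' ∂μ) - V ω|) ^ 2) ω ∂μ =
      ∫ ω, (V ω - ∫ ω', V ω' ∂μ) ^ 2 ∂μ := by
    refine integral_congr_ae (.of_forall fun ω => ?_)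
    simp only [Pi.pow_apply, sq_abs]
    ring
  linarith

end Product

section DoubleCube

variable {α ι : Type*} (A : Set ι)

open Classical in
/-- The permutation of two copies of `ι` that exchanges the copies of the elements of `A`. -/
noncomputable def flipEquiv : ι × Bool ≃ ι × Bool :=
  Function.Involutive.toPerm (fun t => if t.1 ∈ A then (t.1, !t.2) else t) fun t => by
    by_cases h : t.1 ∈ A <;> simp [h]

lemma flipEquiv_fst (t : ι × Bool) : (flipEquiv A t).1 = t.1 := by
  classical
  change (if t.1 ∈ A then (t.1, !t.2) else t).1 = t.1
  split_ifs <;> rfl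

lemma flipEquiv_of_mem {t : ι × Bool} (h : t.1 ∈ A) : flipEquiv A t = (t.1, !t.2) :=
  if_pos h

lemma flipEquiv_of_notMem {t : ι × Bool} (h : t.1 ∉ A) : flipEquiv A t = t :=
  if_neg h

lemma flipEquiv_flipEquiv (t : ι × Bool) : flipEquiv A (flipEquiv A t) = t :=
  Function.Involutive.toPerm_involutive _ t

/-- Exchange the two copies of the coordinates in `A`. -/
noncomputable def flipCoords (z : ι × Bool → α) : ι × Bool → α := fun t => z (flipEquiv A t)

lemma flipCoords_involutive : Function.Involutive (flipCoords A : (ι × Bool → α) → _) := by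
  intro z
  funext t
  simp [flipCoords, flipEquiv_flipEquiv]

end DoubleCube

section LocalDependence

open Finset

variable {α : Type*} [Finite α] [MeasurableSpace α] [MeasurableSingletonClass α]
variable {ι κ : Type*} [Fintype ι] [Fintype κ] [DecidableEq ι]
  (ν : ι → Measure α) [∀ i, IsProbabilityMeasure (ν i)]

/-- A Berry-Esseen bound for sums of `[0, 1]`-valued functions of few coordinates of a product
space, where every coordinate enters few summands. -/
theorem abs_measureReal_normalized_le_sub_stdCdf_le
    (ξ : κ → (ι → α) → ℝ) (A : κ → Finset ι) (hdep : ∀ j, DependsOn (ξ j) (A j : Set ι))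
    (h0 : ∀ j x, 0 ≤ ξ j x) (h1 : ∀ j x, ξ j x ≤ 1) {a b : ℕ} (ha : ∀ j, #(A j) ≤ a)
    (hb : ∀ e, #{j | e ∈ A j} ≤ b)
    (hvar : 0 < variance (fun x => ∑ j, ξ j x) (Measure.pi ν)) (x : ℝ) :
    |(Measure.pi ν).real {y | normalized (fun x => ∑ j, ξ j x) (Measure.pi ν) y ≤ x} - stdCdf x| ≤
      5 * √(Fintype.card κ * ((a * b) ^ 3 * 2)) * (a * b) /
        variance (fun x => ∑ j, ξ j x) (Measure.pi ν) := by
  classical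
  set μ := Measure.pi ν with hμ
  set F : (ι → α) → ℝ := fun x => ∑ j, ξ j x with hF
  set s := √(variance F μ) with hs
  have hs0 : 0 < s := Real.sqrt_pos.2 hvar
  have hss : s * s = variance F μ := Real.mul_self_sqrt hvar.le
  set μ2 := Measure.pi (fun t : ι × Bool => ν t.1) with hμ2
  have int := integrable_of_finite_domain μ2
  set X : (ι × Bool → α) → ι → α := fun z i => z (i, true) with hX
  have mpX : MeasurePreserving X μ2 μ := measurePreserving_pi_double_fst ν
  set η : κ → (ι × Bool → α) → ℝ := fun j z => (ξ j (X z) - ∫ y, ξ j y ∂μ) / s with hη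
  set S : κ → (ι × Bool → α) → (ι × Bool → α) := fun j => flipCoords (A j : Set ι) with hS
  set W : (ι × Bool → α) → ℝ := fun z => normalized F μ (X z) with hW
  have mpS : ∀ j, MeasurePreserving (S j) μ2 μ2 := fun j =>
    measurePreserving_pi_comp_equiv _ _ fun t => by rw [flipEquiv_fst]
  have invS : ∀ j, Function.Involutive (S j) := fun j => flipCoords_involutive _
  have compX : ∀ f : (ι → α) → ℝ, ∫ z, f (X z) ∂μ2 = ∫ y, f y ∂μ := fun f => by
    rw [← mpX.map_eq, integral_map mpX.measurable.aemeasurable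
      (measurable_of_finite f).aestronglyMeasurable]
  have hWsum : ∀ z, W z = ∑ j, η j z := fun z => by
    simp only [hW, hη, normalized, ← sum_div, sum_sub_distrib, hF]
    rw [integral_finsetSum _ fun j _ => integrable_of_finite_domain μ _]
  have hη0 : ∀ j, ∫ z, η j z ∂μ2 = 0 := fun j => by
    simp only [hη]
    rw [integral_div, integral_sub (int _) (int _), compX]
    simp
  have XS_of_notMem : ∀ j z i, i ∉ A j → X (S j z) i = X z i := fun j z i hi => by
    simp [hX, hS, flipCoords, flipEquiv_of_notMem (A j : Set ι) (t := (i, true)) (by simpa)]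
  have XS_of_mem : ∀ j z i, i ∈ A j → X (S j z) i = z (i, false) := fun j z i hi => by
    simp [hX, hS, flipCoords, flipEquiv_of_mem (A j : Set ι) (t := (i, true)) (by simpa)]
  have hind : ∀ j (h : ℝ → ℝ), ∫ z, η j (S j z) * h (W z) ∂μ2 = 0 := by
    intro j h
    rw [integral_mul_of_dependsOn_disjoint (fun t : ι × Bool => ν t.1)
      (f := fun z => η j (S j z)) (g := fun z => h (W z)) (A := {t | t.2 = false})
      (B := {t | t.2 = true})]
    · rw [(mpS j).integral_comp_of_finite, hη0, zero_mul]
    · intro z z' hz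
      simp only [hη]
      rw [hdep j (x := X (S j z)) (y := X (S j z'))]
      intro i hi
      rw [XS_of_mem j z i (by simpa using hi), XS_of_mem j z' i (by simpa using hi)]
      exact hz _ rfl
    · intro z z' hz
      have : X z = X z' := funext fun i => hz _ rfl
      simp only [hW, this]
    · rw [Set.disjoint_left]
      intro t ht ht'
      simp_all
  have key := abs_measureReal_le_sub_stdCdf_le μ2 η S W hWsum mpS invS hind x
  have hleft : μ2.real {z | W z ≤ x} = μ.real {y | normalized F μ y ≤ x} := by
    rw [measureReal_def, measureReal_def, ← mpX.measure_preimage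
      (Set.toFinite _).measurableSet.nullMeasurableSet]
    rfl
  rw [hleft] at key
  refine key.trans ?_
  -- the neighbourhoods in the dependency graph
  set L := a * b with hL
  set nb : κ → Finset κ := fun j => {k | ¬Disjoint (A j) (A k)} with hnb
  have hnbc : ∀ j, #(nb j) ≤ L := card_filter_not_disjoint_le A ha hb
  set B : κ → Finset ι := fun j => (nb j).biUnion A with hB
  have hBa : ∀ j, #(B j) ≤ L * a := fun j =>
    (card_biUnion_le_card_mul _ _ _ fun k _ => ha k).trans (Nat.mul_le_mul_right _ (hnbc j))
  have hBb : ∀ e, #{j | e ∈ B j} ≤ b * L := fun e => by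
    have hsub : ({j | e ∈ B j} : Finset κ) ⊆ ({k | e ∈ A k} : Finset κ).biUnion nb := by
      intro j hj
      simp only [hB, mem_filter, mem_univ, true_and, mem_biUnion] at hj ⊢
      obtain ⟨k, hk, hek⟩ := hj
      refine ⟨k, hek, ?_⟩
      simp only [hnb, mem_filter, mem_univ, true_and] at hk ⊢
      rwa [disjoint_comm]
    exact (card_le_card hsub).trans ((card_biUnion_le_card_mul _ _ _ fun k _ => hnbc k).trans
      (Nat.mul_le_mul_right _ (hb e)))
  set B' : κ → Set (ι × Bool) := fun j => {t | t.1 ∈ B j} with hB'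
  have hB'c : ∀ j, #{k | ¬Disjoint (B' j) (B' k)} ≤ L ^ 3 := fun j => by
    have := card_filter_not_disjoint_le B hBa hBb j
    have e : ∀ k, Disjoint (B' j) (B' k) ↔ Disjoint (B j) (B k) := fun k => by
      rw [Set.disjoint_left, disjoint_left]
      exact ⟨fun h i hi hi' => h (a := (i, true)) hi hi', fun h t ht ht' => h ht ht'⟩
    simp only [e]
    calc _ ≤ _ := this
      _ = L ^ 3 := by rw [hL]; ring
  have A_sub_B : ∀ j, A j ⊆ B j := fun j i hi => by
    simp only [hB, hnb, mem_biUnion, mem_filter, mem_univ, true_and]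
    exact ⟨j, fun h => disjoint_left.1 h hi hi, hi⟩
  set D : κ → (ι × Bool → α) → ℝ := fun j z => η j z - η j (S j z) with hD
  set Δ : κ → (ι × Bool → α) → ℝ := fun j z => W z - W (S j z) with hΔ
  have hΔsum : ∀ j z, Δ j z = ∑ k ∈ nb j, (η k z - η k (S j z)) := fun j z => by
    simp only [hΔ, hWsum, ← sum_sub_distrib]
    refine (sum_subset (subset_univ _) fun k _ hk => ?_).symm
    simp only [hnb, mem_filter, mem_univ, true_and, not_not] at hk
    simp only [hη]
    rw [hdep k (x := X (S j z)) (y := X z), sub_self]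
    intro i hi
    exact XS_of_notMem j z i (disjoint_right.1 hk (by simpa using hi))
  have ηdep : ∀ j k z z', k ∈ nb j → (∀ t ∈ B' j, z t = z' t) →
      η k z = η k z' ∧ η k (S j z) = η k (S j z') := by
    intro j k z z' hk hz
    have hsub : ∀ i ∈ A k, i ∈ B j := fun i hi => by
      simp only [hB, mem_biUnion]
      exact ⟨k, hk, hi⟩
    constructor
    · simp only [hη]
      rw [hdep k (x := X z) (y := X z')]
      exact fun i hi => hz (i, true) (hsub i hi)
    · simp only [hη]
      rw [hdep k (x := X (S j z)) (y := X (S j z'))]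
      intro i hi
      by_cases hij : i ∈ A j
      · rw [XS_of_mem j z i hij, XS_of_mem j z' i hij]
        exact hz (i, false) (hsub i hi)
      · rw [XS_of_notMem j z i hij, XS_of_notMem j z' i hij]
        exact hz (i, true) (hsub i hi)
  have Δdep : ∀ j, DependsOn (Δ j) (B' j) := fun j z z' hz => by
    rw [hΔsum, hΔsum]
    refine sum_congr rfl fun k hk => ?_
    obtain ⟨e1, e2⟩ := ηdep j k z z' hk hz
    rw [e1, e2]
  have Ddep : ∀ j, DependsOn (D j) (B' j) := fun j z z' hz => by
    have hdj : ∀ w w' : ι → α, (∀ i ∈ A j, w i = w' i) → ξ j w = ξ j w' :=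
      fun w w' h => hdep j h
    simp only [hD, hη]
    rw [hdj (X z) (X z') fun i hi => hz (i, true) (A_sub_B j hi),
      hdj (X (S j z)) (X (S j z')) fun i hi => ?_]
    rw [XS_of_mem j z i hi, XS_of_mem j z' i hi]
    exact hz (i, false) (A_sub_B j hi)
  have ηdiff : ∀ j z z', |η j z - η j z'| ≤ 1 / s := fun j z z' => by
    simp only [hη, ← sub_div, sub_sub_sub_cancel_right]
    rw [abs_div, abs_of_pos hs0]
    gcongr
    rw [abs_le]
    constructor <;> linarith [h0 j (X z), h1 j (X z), h0 j (X z'), h1 j (X z')]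
  have Dbd : ∀ j z, |D j z| ≤ 1 / s := fun j z => ηdiff j z _
  have Δbd : ∀ j z, |Δ j z| ≤ L / s := fun j z => by
    rw [hΔsum]
    refine (abs_sum_le_sum_abs _ _).trans ((sum_le_card_nsmul _ _ (1 / s)
      fun k _ => ηdiff k z _).trans ?_)
    rw [nsmul_eq_mul, mul_one_div]
    gcongr
    exact_mod_cast hnbc j
  have prodbd : ∀ j z, |D j z| * |Δ j z| ≤ L / variance F μ := fun j z => by
    calc |D j z| * |Δ j z| ≤ 1 / s * (L / s) :=
          mul_le_mul (Dbd j z) (Δbd j z) (abs_nonneg _) (by positivity)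
      _ = L / variance F μ := by rw [← hss]; field_simp
  have hsv : √(Fintype.card κ * ((L ^ 3 : ℕ) * (2 * (L / variance F μ) ^ 2))) =
      √(Fintype.card κ * ((a * b) ^ 3 * 2)) * (a * b) / variance F μ := by
    have e : (Fintype.card κ * ((L ^ 3 : ℕ) * (2 * (L / variance F μ) ^ 2)) : ℝ) =
        Fintype.card κ * ((a * b) ^ 3 * 2) * ((a * b) / variance F μ) ^ 2 := by
      rw [hL]
      push_cast
      ring
    rw [e, Real.sqrt_mul (by positivity), Real.sqrt_sq (by positivity)]
    ring
  -- the two error terms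
  have term2 : ∫ z, |∑ j, |D j z| * Δ j z| ∂μ2 ≤
      √(Fintype.card κ * ((a * b) ^ 3 * 2)) * (a * b) / variance F μ := by
    have hz : ∫ z, ∑ j, |D j z| * Δ j z ∂μ2 = 0 := by
      rw [integral_finsetSum _ fun j _ => int _]
      refine sum_eq_zero fun j _ => ?_
      have h := (mpS j).integral_comp_of_finite fun z => |D j z| * Δ j z
      have e : ∀ z, |D j (S j z)| * Δ j (S j z) = -(|D j z| * Δ j z) := fun z => by
        simp only [hD, hΔ, invS j z]
        rw [abs_sub_comm]
        ring
      simp only [e, integral_neg] at h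
      linarith
    have h := integral_abs_sub_le_sqrt_variance μ2 fun z => ∑ j, |D j z| * Δ j z
    simp only [hz, zero_sub, abs_neg] at h
    rw [← hsv]
    refine h.trans (Real.sqrt_le_sqrt ?_)
    refine variance_sum_le_of_dependsOn _ (fun j z => |D j z| * Δ j z) B' (fun j z z' hz => ?_)
      (fun j z => ?_) hB'c
    · simp only [Ddep j hz, Δdep j hz]
    · rw [abs_mul, abs_abs]
      exact prodbd j z
  have term1 : ∫ z, |1 - 1 / 2 * ∑ j, D j z * Δ j z| ∂μ2 ≤
      √(Fintype.card κ * ((a * b) ^ 3 * 2)) * (a * b) / variance F μ := by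
    have hz : ∫ z, ∑ j, 1 / 2 * (D j z * Δ j z) ∂μ2 = 1 := by
      rw [integral_finsetSum _ fun j _ => int _]
      have hj : ∀ j, ∫ z, 1 / 2 * (D j z * Δ j z) ∂μ2 = ∫ z, η j z * W z ∂μ2 := fun j => by
        have c1 : ∫ z, η j (S j z) * W z ∂μ2 = 0 := hind j id
        have c2 := (mpS j).integral_comp_of_finite fun z => η j z * W z
        have c3 := (mpS j).integral_comp_of_finite fun z => η j (S j z) * W z
        simp only [invS j _] at c3
        rw [integral_const_mul]
        have e : ∀ z, D j z * Δ j z = η j z * W z - η j z * W (S j z) - η j (S j z) * W z +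
            η j (S j z) * W (S j z) := fun z => by
          simp only [hD, hΔ]
          ring
        simp only [e]
        rw [integral_add (int _) (int _), integral_sub (int _) (int _),
          integral_sub (int _) (int _)]
        linarith
      simp only [hj]
      rw [← integral_finsetSum _ fun j _ => int _]
      simp only [← sum_mul, ← hWsum]
      rw [compX fun y => normalized F μ y * normalized F μ y]
      have e : ∀ y, normalized F μ y * normalized F μ y =
          (F y - ∫ y', F y' ∂μ) ^ 2 / variance F μ := fun y => by
        rw [normalized, ← hs, ← hss]
        field_simp
      simp only [e]
      rw [integral_div, ← variance_eq_integral (measurable_of_finite F).aemeasurable,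
        div_self hvar.ne']
    have h := integral_abs_sub_le_sqrt_variance μ2 fun z => ∑ j, 1 / 2 * (D j z * Δ j z)
    simp only [mul_sum]
    simp only [hz] at h
    rw [← hsv]
    refine h.trans (Real.sqrt_le_sqrt ?_)
    refine variance_sum_le_of_dependsOn _ (fun j z => 1 / 2 * (D j z * Δ j z)) B'
      (fun j z z' hz => ?_) (fun j z => ?_) hB'c
    · simp only [Ddep j hz, Δdep j hz]
    · rw [abs_mul, abs_mul, abs_of_nonneg (by norm_num : (0 : ℝ) ≤ 1 / 2)]
      have := prodbd j z
      have := mul_nonneg (abs_nonneg (D j z)) (abs_nonneg (Δ j z))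
      linarith
  have hnn : 0 ≤ √(Fintype.card κ * ((a * b) ^ 3 * 2)) * (a * b) / variance F μ := by positivity
  calc _ ≤ √(Fintype.card κ * ((a * b) ^ 3 * 2)) * (a * b) / variance F μ +
        2 * (√(Fintype.card κ * ((a * b) ^ 3 * 2)) * (a * b) / variance F μ) := by
        gcongr
    _ ≤ 5 * (√(Fintype.card κ * ((a * b) ^ 3 * 2)) * (a * b) / variance F μ) := by linarith
    _ = _ := by ring

end LocalDependence

/-! ### Counting the top vertices of percolation clusters -/

section TopVertices

open Finset

variable {ι κ : Type*} [Fintype ι] [DecidableEq κ] (child par : ι → κ)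

/-- The indicator that the edge to the parent of `v` is absent or closed while some edge to a
child of `v` is open; here `x` tells which edges are open. -/
noncomputable def topIndicator (v : κ) (x : ι → Bool) : ℝ :=
  if (∀ c, child c = v → x c = false) ∧ ∃ c, par c = v ∧ x c = true then 1 else 0

/-- The edges at the vertex `v`. -/
def edgesAt (v : κ) : Finset ι := {c | child c = v ∨ par c = v}

variable {child par}

lemma mem_edgesAt {v : κ} {c : ι} : c ∈ edgesAt child par v ↔ child c = v ∨ par c = v := by
  simp [edgesAt]

lemma card_filter_child_eq_le (hinj : Function.Injective child) (v : κ) :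
    #{c | child c = v} ≤ 1 :=
  card_le_one.2 fun a ha b hb => hinj (by simp_all)

lemma integral_pi_ite (ν : ι → Measure Bool) [∀ i, IsProbabilityMeasure (ν i)] {p : ℝ}
    (hν : ∀ i, (ν i).real {true} = p) (c : ι) :
    ∫ x, (if x c = true then (1 : ℝ) else 0) ∂Measure.pi ν = p := by
  have h := measurePreserving_eval ν c
  have h2 := integral_map (μ := Measure.pi ν) h.measurable.aemeasurable
    (f := fun b : Bool => if b = true then (1 : ℝ) else 0)
    (measurable_of_finite _).aestronglyMeasurable
  rw [h.map_eq] at h2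
  rw [← hν c, ← integral_indicator_one (Set.toFinite {true}).measurableSet]
  rw [show (fun x : ι → Bool => if x c = true then (1 : ℝ) else 0) =
    fun x => if Function.eval c x = true then (1 : ℝ) else 0 from rfl, ← h2]
  refine integral_congr_ae (.of_forall fun b => ?_)
  cases b <;> simp

lemma integral_centred_mul_eq_zero (ν : ι → Measure Bool) [∀ i, IsProbabilityMeasure (ν i)]
    {p : ℝ} (hν : ∀ i, (ν i).real {true} = p) (c : ι)
    {g : (ι → Bool) → ℝ} (hg : DependsOn g ({c}ᶜ : Set ι)) :
    ∫ x, ((if x c = true then (1 : ℝ) else 0) - p) * g x ∂Measure.pi ν = 0 := by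
  rw [integral_mul_of_dependsOn_disjoint ν (A := {c})
    (f := fun x => (if x c = true then (1 : ℝ) else 0) - p) (fun x y h => by simp [h c rfl]) hg
    disjoint_compl_right, integral_sub (integrable_of_finite_domain _ _)
    (integrable_of_finite_domain _ _), integral_pi_ite ν hν]
  simp

lemma dependsOn_topIndicator (v : κ) :
    DependsOn (topIndicator child par v) (edgesAt child par v : Set ι) := by
  intro x y h
  have h' : ∀ c, child c = v ∨ par c = v → x c = y c := fun c hc => h c (by
    simpa [mem_edgesAt] using hc)
  have e1 : (∀ c, child c = v → x c = false) ↔ ∀ c, child c = v → y c = false :=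
    forall₂_congr fun c hc => by rw [h' c (.inl hc)]
  have e2 : (∃ c, par c = v ∧ x c = true) ↔ ∃ c, par c = v ∧ y c = true :=
    exists_congr fun c => and_congr_right fun hc => by rw [h' c (.inr hc)]
  simp only [topIndicator, e1, e2]

lemma topIndicator_nonneg (v : κ) (x : ι → Bool) : 0 ≤ topIndicator child par v x := by
  unfold topIndicator; split_ifs <;> norm_num

lemma topIndicator_le_one (v : κ) (x : ι → Bool) : topIndicator child par v x ≤ 1 := by
  unfold topIndicator; split_ifs <;> norm_num

variable [DecidableEq ι]

variable (child par) in
/-- The edges that share a vertex with the edge `c`. -/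
def edgesNear (c : ι) : Finset ι := edgesAt child par (child c) ∪ edgesAt child par (par c)

variable (child par) in
/-- The indicator that all edges near `c`, except possibly `c` itself, are closed. -/
noncomputable def isolatedIndicator (c : ι) (x : ι → Bool) : ℝ :=
  if ∀ e ∈ edgesNear child par c, e ≠ c → x e = false then 1 else 0

variable (child par) in
/-- The centred state of the edge `c`, restricted to the event that `c` is isolated. -/
noncomputable def isolatedEdge (p : ℝ) (c : ι) (x : ι → Bool) : ℝ :=
  ((if x c = true then 1 else 0) - p) * isolatedIndicator child par c x

lemma card_edgesAt_le (hinj : Function.Injective child) {d : ℕ} (hd : ∀ v, #{c | par c = v} ≤ d)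
    (v : κ) : #(edgesAt child par v) ≤ d + 1 := by
  rw [edgesAt, filter_or, add_comm]
  exact (card_union_le _ _).trans (add_le_add (card_filter_child_eq_le hinj v) (hd v))

lemma card_filter_mem_edgesAt_le [Fintype κ] (e : ι) :
    #{v | e ∈ edgesAt child par v} ≤ 2 := by
  refine (card_le_card (t := {child e, par e}) fun v hv => ?_).trans card_le_two
  simp only [mem_filter, mem_univ, true_and, mem_edgesAt, mem_insert, mem_singleton] at hv ⊢
  tauto

lemma card_edgesNear_le (hinj : Function.Injective child) {d : ℕ} (hd : ∀ v, #{c | par c = v} ≤ d)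
    (c : ι) : #(edgesNear child par c) ≤ 2 * (d + 1) := by
  rw [two_mul]
  exact (card_union_le _ _).trans (add_le_add (card_edgesAt_le hinj hd _)
    (card_edgesAt_le hinj hd _))

lemma card_filter_mem_edgesNear_le (hinj : Function.Injective child) {d : ℕ}
    (hd : ∀ v, #{c | par c = v} ≤ d) (e : ι) :
    #{c | e ∈ edgesNear child par c} ≤ 2 * (d + 1) := by
  have hsub : ({c | e ∈ edgesNear child par c} : Finset ι) ⊆
      edgesAt child par (child e) ∪ edgesAt child par (par e) := fun c hc => by
    simp only [edgesNear, mem_filter, mem_univ, true_and, mem_union, mem_edgesAt] at hc ⊢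
    tauto
  exact (card_le_card hsub).trans (card_edgesNear_le hinj hd e)

lemma dependsOn_isolatedIndicator (c : ι) :
    DependsOn (isolatedIndicator child par c) ((edgesNear child par c).erase c : Set ι) := by
  intro x y h
  have e1 : (∀ e ∈ edgesNear child par c, e ≠ c → x e = false) ↔
      ∀ e ∈ edgesNear child par c, e ≠ c → y e = false :=
    forall₂_congr fun e he => forall_congr' fun hne => by rw [h e (by simp [he, hne])]
  simp only [isolatedIndicator, e1]

lemma mem_edgesNear_self (c : ι) : c ∈ edgesNear child par c := by
  simp [edgesNear, mem_edgesAt]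

lemma dependsOn_isolatedEdge (p : ℝ) (c : ι) :
    DependsOn (isolatedEdge child par p c) (edgesNear child par c : Set ι) := by
  intro x y h
  have h1 : x c = y c := h c (by simpa using mem_edgesNear_self c)
  have h2 := dependsOn_isolatedIndicator (child := child) (par := par) c (x := x) (y := y)
    fun e he => h e (by
      simp only [coe_erase, Set.mem_sdiff] at he
      exact he.1)
  simp only [isolatedEdge, h1, h2]

lemma abs_isolatedEdge_le {p : ℝ} (hp0 : 0 ≤ p) (hp1 : p ≤ 1) (c : ι) (x : ι → Bool) :
    |isolatedEdge child par p c x| ≤ 1 := by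
  unfold isolatedEdge isolatedIndicator
  rw [abs_le]
  split_ifs <;> constructor <;> linarith

section Moments

variable (ν : ι → Measure Bool) [∀ i, IsProbabilityMeasure (ν i)] {p : ℝ}

lemma integral_isolatedIndicator (hν : ∀ i, (ν i).real {true} = p) (c : ι) :
    ∫ x, isolatedIndicator child par c x ∂Measure.pi ν =
      (1 - p) ^ #((edgesNear child par c).erase c) := by
  have hf : ∀ i, (ν i).real {false} = 1 - p := fun i => by
    rw [← hν i, ← probReal_compl_eq_one_sub (Set.toFinite _).measurableSet]
    congr 1
    ext b
    cases b <;> simp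
  have e : (fun x => isolatedIndicator child par c x) = Set.indicator (Set.univ.pi fun i =>
      if i ∈ (edgesNear child par c).erase c then ({false} : Set Bool) else Set.univ) 1 := by
    funext x
    simp only [isolatedIndicator, Set.indicator, Pi.one_apply]
    congr 1
    simp only [Set.mem_pi, Set.mem_univ, true_imp_iff, eq_iff_iff]
    refine forall_congr' fun i => ?_
    split_ifs with h
    · simp only [mem_erase] at h
      simp [h]
    · simp only [mem_erase, not_and] at h
      simp only [Set.mem_univ, iff_true]
      exact fun h1 h2 => absurd h1 (h h2)
  rw [e, integral_indicator_one (Set.toFinite _).measurableSet, measureReal_def, Measure.pi_pi,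
    ENNReal.toReal_prod]
  have : ∀ i, ((ν i) (if i ∈ (edgesNear child par c).erase c then ({false} : Set Bool)
      else Set.univ)).toReal = if i ∈ (edgesNear child par c).erase c then 1 - p else 1 := by
    intro i
    split_ifs
    · exact hf i
    · exact (congrArg ENNReal.toReal measure_univ).trans ENNReal.toReal_one
  simp only [this]
  rw [prod_ite_mem, univ_inter, prod_const]

lemma integral_isolatedEdge (hν : ∀ i, (ν i).real {true} = p) (c : ι) :
    ∫ x, isolatedEdge child par p c x ∂Measure.pi ν = 0 :=
  integral_centred_mul_eq_zero ν hν c ((dependsOn_isolatedIndicator c).mono (by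
    intro e he
    simp_all))

lemma integral_topIndicator_mul_isolatedEdge (hne : ∀ c, par c ≠ child c)
    (hν : ∀ i, (ν i).real {true} = p) (v : κ) (c : ι) :
    ∫ x, topIndicator child par v x * isolatedEdge child par p c x ∂Measure.pi ν =
      if v = par c then p * (1 - p) * (1 - p) ^ #((edgesNear child par c).erase c) else 0 := by
  split_ifs with hv
  · subst hv
    have e : ∀ x, topIndicator child par (par c) x * isolatedEdge child par p c x =
        (1 - p) * ((if x c = true then (1 : ℝ) else 0) * isolatedIndicator child par c x) := by
      intro x
      by_cases hB : ∀ e ∈ edgesNear child par c, e ≠ c → x e = false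
      · have h1 : ∀ c', child c' = par c → x c' = false := fun c' hc' =>
          hB c' (by simp [edgesNear, mem_edgesAt, hc']) fun h => hne c (by rw [← hc', h])
        have h2 : (∃ c', par c' = par c ∧ x c' = true) ↔ x c = true := by
          refine ⟨fun ⟨c', hc', hx⟩ => ?_, fun h => ⟨c, rfl, h⟩⟩
          by_cases h : c' = c
          · rwa [← h]
          · have := hB c' (by simp [edgesNear, mem_edgesAt, hc']) h
            simp_all
        rw [topIndicator, isolatedEdge, isolatedIndicator, if_pos hB]
        have h3 : ((∀ c', child c' = par c → x c' = false) ∧ ∃ c', par c' = par c ∧ x c' = true) ↔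
            x c = true := ⟨fun h => h2.1 h.2, fun h => ⟨h1, h2.2 h⟩⟩
        simp only [h3]
        cases hx : x c <;> simp
      · simp [isolatedEdge, isolatedIndicator, hB]
    simp only [e]
    rw [integral_const_mul, integral_mul_of_dependsOn_disjoint ν (A := {c})
      (f := fun x => if x c = true then (1 : ℝ) else 0) (fun x y h => by simp [h c rfl])
      (dependsOn_isolatedIndicator c) (by simp), integral_pi_ite ν hν,
      integral_isolatedIndicator ν hν]
    ring
  · by_cases hvc : child c = v
    · subst hvc
      have e : ∀ x, topIndicator child par (child c) x * isolatedEdge child par p c x = 0 := by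
        intro x
        by_contra h
        have h1 := left_ne_zero_of_mul h
        have h2 := right_ne_zero_of_mul (right_ne_zero_of_mul h)
        simp only [topIndicator, ne_eq, ite_eq_right_iff, one_ne_zero, imp_false, not_not] at h1
        simp only [isolatedIndicator, ne_eq, ite_eq_right_iff, one_ne_zero, imp_false,
          not_not] at h2
        obtain ⟨-, c', hc', hx⟩ := h1
        have := h2 c' (by simp [edgesNear, mem_edgesAt, hc']) fun h => hne c (by rw [← hc', h])
        simp_all
      simp [e]
    · have hc : c ∉ edgesAt child par v := by
        rw [mem_edgesAt]
        rintro (h | h)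
        · exact hvc h
        · exact hv h.symm
      have := integral_centred_mul_eq_zero ν hν c
        (g := fun x => isolatedIndicator child par c x * topIndicator child par v x)
        fun x y h => by
          simp only
          rw [dependsOn_isolatedIndicator c (x := x) (y := y) fun e he => h e (by simp_all),
            dependsOn_topIndicator v (x := x) (y := y) fun e he => h e ?_]
          rintro rfl
          exact hc (by simpa using he)
      rw [← this]
      refine integral_congr_ae (.of_forall fun x => ?_)
      simp only [isolatedEdge]
      ring

lemma le_variance_sum_topIndicator [Fintype κ] (hinj : Function.Injective child)
    (hne : ∀ c, par c ≠ child c) {d : ℕ} (hd : ∀ v, #{c | par c = v} ≤ d)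
    (hp0 : 0 < p) (hp1 : p < 1) (hν : ∀ i, (ν i).real {true} = p) :
    (p * (1 - p) * (1 - p) ^ (2 * (d + 1))) ^ 2 / (2 * (2 * (d + 1)) ^ 2) * Fintype.card ι ≤
      variance (fun x => ∑ v, topIndicator child par v x) (Measure.pi ν) := by
  classical
  set μ := Measure.pi ν
  have hmem := memLp_of_finite_domain μ
  set F : (ι → Bool) → ℝ := fun x => ∑ v, topIndicator child par v x
  set T : (ι → Bool) → ℝ := fun x => ∑ c, isolatedEdge child par p c x
  set k := p * (1 - p) * (1 - p) ^ (2 * (d + 1)) with hk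
  set L : ℝ := (2 * (d + 1)) ^ 2 with hL
  have hLpos : 0 < L := by positivity
  have hT : variance T μ ≤ Fintype.card ι * (L * 2) := by
    have h := variance_sum_le_of_dependsOn ν (fun c => isolatedEdge child par p c)
      (fun c => (edgesNear child par c : Set ι)) (fun c => dependsOn_isolatedEdge p c)
      (abs_isolatedEdge_le hp0.le hp1.le) (L := (2 * (d + 1)) * (2 * (d + 1))) fun c => by
        simp only [disjoint_coe]
        exact card_filter_not_disjoint_le _ (card_edgesNear_le hinj hd)
          (card_filter_mem_edgesNear_le hinj hd) c
    refine h.trans_eq ?_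
    rw [hL]
    push_cast
    ring
  have hcov : k * Fintype.card ι ≤ covariance F T μ := by
    have h1 : covariance F T μ = ∑ v, ∑ c, covariance (topIndicator child par v)
        (isolatedEdge child par p c) μ :=
      covariance_fun_sum_fun_sum (fun _ => hmem _) (fun _ => hmem _)
    have h2 : ∀ v c, covariance (topIndicator child par v) (isolatedEdge child par p c) μ =
        if v = par c then p * (1 - p) * (1 - p) ^ #((edgesNear child par c).erase c) else 0 := by
      intro v c
      rw [covariance_eq_sub (hmem _) (hmem _), integral_isolatedEdge ν hν, mul_zero, sub_zero]
      exact integral_topIndicator_mul_isolatedEdge ν hne hν v c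
    rw [h1, sum_comm]
    simp only [h2, sum_ite_eq', mem_univ, if_true]
    calc k * Fintype.card ι = ∑ _c : ι, k := by simp [mul_comm]
      _ ≤ _ := sum_le_sum fun c _ => by
        have hq : 0 < 1 - p := sub_pos.2 hp1
        rw [hk]
        refine mul_le_mul_of_nonneg_left ?_ (by positivity)
        exact pow_le_pow_of_le_one hq.le (by linarith)
          ((card_erase_le).trans (card_edgesNear_le hinj hd c))
  have hkpos : 0 < k := by
    have hq : 0 < 1 - p := sub_pos.2 hp1
    positivity
  set t := k / (2 * L) with ht
  have htpos : 0 < t := by positivity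
  have hvar : 0 ≤ variance F μ - 2 * (t * covariance F T μ) + t ^ 2 * variance T μ := by
    have h := variance_nonneg (F - fun x => t * T x) μ
    rw [variance_sub (hmem _) (hmem _), covariance_const_mul_right, variance_const_mul] at h
    linarith
  have h1 := mul_le_mul_of_nonneg_left hcov htpos.le
  have h2 := mul_le_mul_of_nonneg_left hT (sq_nonneg t)
  have e : k ^ 2 / (2 * L) * Fintype.card ι =
      2 * (t * (k * Fintype.card ι)) - t ^ 2 * (Fintype.card ι * (L * 2)) := by
    rw [ht]
    field_simp
    ring
  rw [e]
  linarith

end Moments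

/-- The Berry-Esseen bound for the number of top vertices. -/
theorem exists_abs_measureReal_topIndicator_le (d : ℕ) {p : ℝ} (hp0 : 0 < p) (hp1 : p < 1) :
    ∃ C : ℝ, 0 < C ∧ ∀ (ι κ : Type*) [Fintype ι] [Nonempty ι] [Fintype κ] [DecidableEq ι]
      [DecidableEq κ] (child par : ι → κ), Function.Injective child → (∀ c, par c ≠ child c) →
      (∀ v, #{c | par c = v} ≤ d) → Fintype.card κ ≤ 2 * Fintype.card ι →
      ∀ (ν : ι → Measure Bool) [∀ i, IsProbabilityMeasure (ν i)],
      (∀ i, (ν i).real {true} = p) → ∀ x : ℝ,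
      |(Measure.pi ν).real {y | normalized (fun x => ∑ v, topIndicator child par v x)
        (Measure.pi ν) y ≤ x} - stdCdf x| ≤ C / √(Fintype.card ι) := by
  have hq : 0 < 1 - p := sub_pos.2 hp1
  set k := (p * (1 - p) * (1 - p) ^ (2 * (d + 1))) ^ 2 / (2 * (2 * (d + 1) : ℝ) ^ 2) with hk
  have hkpos : 0 < k := by positivity
  refine ⟨5 * √(2 * (((d + 1) * 2) ^ 3 * 2)) * ((d + 1) * 2) / k, by positivity, ?_⟩
  intro ι κ _ _ _ _ _ child par hinj hne hd hcard ν _ hν x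
  have hι : (0 : ℝ) < Fintype.card ι := by exact_mod_cast Fintype.card_pos
  have hlow := le_variance_sum_topIndicator ν hinj hne hd hp0 hp1 hν
  rw [← hk] at hlow
  have hvar := (mul_pos hkpos hι).trans_le hlow
  have h := abs_measureReal_normalized_le_sub_stdCdf_le ν (topIndicator child par)
    (edgesAt child par) dependsOn_topIndicator topIndicator_nonneg topIndicator_le_one
    (card_edgesAt_le hinj hd) card_filter_mem_edgesAt_le hvar x
  refine h.trans ?_
  have hs : √(Fintype.card κ * ((((d + 1 : ℕ) : ℝ) * (2 : ℕ)) ^ 3 * 2)) ≤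
      √(2 * (((d + 1) * 2) ^ 3 * 2)) * √(Fintype.card ι) := by
    rw [← Real.sqrt_mul (by positivity)]
    refine Real.sqrt_le_sqrt ?_
    have : (Fintype.card κ : ℝ) ≤ 2 * Fintype.card ι := by exact_mod_cast hcard
    push_cast
    calc _ ≤ (2 * Fintype.card ι : ℝ) * (((d + 1) * 2) ^ 3 * 2) := by gcongr
      _ = _ := by ring
  calc _ ≤ 5 * (√(2 * (((d + 1) * 2) ^ 3 * 2)) * √(Fintype.card ι)) *
        (((d + 1 : ℕ) : ℝ) * (2 : ℕ)) / (k * Fintype.card ι) := by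
        gcongr
    _ = _ := by
        have hsq : √(Fintype.card ι : ℝ) * √(Fintype.card ι : ℝ) = Fintype.card ι :=
          Real.mul_self_sqrt hι.le
        have hsp := Real.sqrt_pos.2 hι
        rw [div_div, div_eq_div_iff (by positivity) (by positivity)]
        push_cast
        linear_combination (5 * √(2 * (((d + 1) * 2) ^ 3 * 2)) * ((d + 1) * 2) * k : ℝ) * hsq

end TopVertices

/-! ### Clusters and their top vertices -/

section Clusters

variable {ι κ : Type*} {child par : ι → κ} {depth : κ → ℕ}

open Classical in
/-- The vertex reached from `v` by climbing along open edges as far as possible. -/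
noncomputable def clusterTop (hdepth : ∀ c, depth (par c) < depth (child c)) (x : ι → Bool)
    (v : κ) : κ :=
  if h : ∃ c, child c = v ∧ x c = true then clusterTop hdepth x (par h.choose) else v
termination_by depth v
decreasing_by exact (hdepth h.choose).trans_eq (congrArg depth h.choose_spec.1)

variable (hdepth : ∀ c, depth (par c) < depth (child c)) {x : ι → Bool}

lemma clusterTop_of_closed {v : κ} (h : ∀ c, child c = v → x c = false) :
    clusterTop hdepth x v = v := by
  rw [clusterTop, dif_neg]
  rintro ⟨c, hc, hx⟩
  simp [h c hc] at hx

lemma clusterTop_child (hinj : Function.Injective child) {c : ι} (hx : x c = true) :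
    clusterTop hdepth x (child c) = clusterTop hdepth x (par c) := by
  have h : ∃ c', child c' = child c ∧ x c' = true := ⟨c, rfl, hx⟩
  rw [clusterTop, dif_pos h, hinj h.choose_spec.1]

lemma clusterTop_closed (v : κ) : ∀ c, child c = clusterTop hdepth x v → x c = false := by
  induction hn : depth v using Nat.strong_induction_on generalizing v with
  | _ n ih =>
    subst hn
    rw [clusterTop]
    split_ifs with h
    · exact ih _ ((hdepth h.choose).trans_eq (congrArg depth h.choose_spec.1)) _ rfl
    · intro c hc
      by_contra hx
      exact h ⟨c, hc, by simpa using hx⟩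

variable {H : SimpleGraph κ}
  (hH : ∀ u v, H.Adj u v ↔
    ∃ c, x c = true ∧ ((u = child c ∧ v = par c) ∨ (v = child c ∧ u = par c)))

include hH in
lemma reachable_clusterTop (v : κ) : H.Reachable v (clusterTop hdepth x v) := by
  induction hn : depth v using Nat.strong_induction_on generalizing v with
  | _ n ih =>
    subst hn
    rw [clusterTop]
    split_ifs with h
    · refine SimpleGraph.Reachable.trans (SimpleGraph.Adj.reachable ?_)
        (ih _ ((hdepth h.choose).trans_eq (congrArg depth h.choose_spec.1)) _ rfl)
      exact (hH _ _).2 ⟨h.choose, h.choose_spec.2, .inl ⟨h.choose_spec.1.symm, rfl⟩⟩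
    · exact SimpleGraph.Reachable.refl _

include hH in
lemma clusterTop_eq_of_reachable (hinj : Function.Injective child) {u v : κ}
    (h : H.Reachable u v) : clusterTop hdepth x u = clusterTop hdepth x v := by
  obtain ⟨w⟩ := h
  induction w with
  | nil => rfl
  | cons hadj _ ih =>
    rw [← ih]
    obtain ⟨c, hx, ⟨rfl, rfl⟩ | ⟨rfl, rfl⟩⟩ := (hH _ _).1 hadj
    · exact clusterTop_child hdepth hinj hx
    · exact (clusterTop_child hdepth hinj hx).symm

lemma SimpleGraph.Reachable.exists_adj_of_ne {u v : κ} (h : H.Reachable u v) (hne : u ≠ v) :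
    ∃ w, H.Adj u w := by
  obtain ⟨w⟩ := h
  cases w with
  | nil => exact absurd rfl hne
  | cons hadj _ => exact ⟨_, hadj⟩

include hdepth hH in
/-- The clusters with at least one edge are counted by their top vertices. -/
theorem numEdgeComponents_eq_sum_topIndicator [Fintype ι] [Fintype κ] [DecidableEq κ]
    (hinj : Function.Injective child) :
    (numEdgeComponents H : ℝ) = ∑ v, topIndicator child par v x := by
  classical
  set T : Finset κ := {v | (∀ c, child c = v → x c = false) ∧ ∃ c, par c = v ∧ x c = true}
    with hT
  have himg : {c : H.ConnectedComponent | ∃ u v, H.Adj u v ∧ H.connectedComponentMk u = c} =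
      H.connectedComponentMk '' (T : Set κ) := by
    ext C
    constructor
    · rintro ⟨u, v, huv, rfl⟩
      set t := clusterTop hdepth x u
      have htu : H.Reachable t u := (reachable_clusterTop hdepth hH u).symm
      have htv : H.Reachable t v := htu.trans huv.reachable
      have hw : ∃ w, H.Adj t w := by
        by_cases h : t = u
        · exact htv.exists_adj_of_ne (h ▸ huv.ne)
        · exact htu.exists_adj_of_ne h
      refine ⟨t, ?_, SimpleGraph.ConnectedComponent.sound htu⟩
      have hcl := clusterTop_closed hdepth (x := x) u
      obtain ⟨w, hw⟩ := hw
      obtain ⟨c, hx, ⟨h1, -⟩ | ⟨-, h1⟩⟩ := (hH _ _).1 hw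
      · rw [hcl c h1.symm] at hx
        exact absurd hx (by simp)
      · simp only [hT, Finset.coe_filter, Finset.mem_univ, true_and, Set.mem_ofPred_eq]
        exact ⟨hcl, c, h1.symm, hx⟩
    · rintro ⟨v, hv, rfl⟩
      simp only [hT, Finset.coe_filter, Finset.mem_univ, true_and, Set.mem_ofPred_eq] at hv
      obtain ⟨-, c, rfl, hx⟩ := hv
      exact ⟨par c, child c, (hH _ _).2 ⟨c, hx, .inr ⟨rfl, rfl⟩⟩, rfl⟩
  have hinjOn : Set.InjOn H.connectedComponentMk (T : Set κ) := by
    intro u hu v hv huv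
    simp only [hT, Finset.coe_filter, Finset.mem_univ, true_and, Set.mem_ofPred_eq] at hu hv
    have h := clusterTop_eq_of_reachable hdepth hH hinj (SimpleGraph.ConnectedComponent.exact huv)
    rwa [clusterTop_of_closed hdepth hu.1, clusterTop_of_closed hdepth hv.1] at h
  rw [numEdgeComponents, himg, hinjOn.ncard_image, Set.ncard_coe_finset]
  simp only [topIndicator, Finset.sum_boole, hT]

end Clusters

/-! ### Rooted trees -/

section RootedTree

variable {V : Type*} {G : SimpleGraph V} {r : V}

lemma exists_adj_dist_eq_add_one (hG : G.IsTree) {v : V} (hv : v ≠ r) :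
    ∃ w, G.Adj v w ∧ G.dist r v = G.dist r w + 1 := by
  obtain ⟨w, hw⟩ := hG.connected.exists_walk_length_eq_dist v r
  cases w with
  | nil => exact absurd rfl hv
  | @cons _ u _ hadj w' =>
    refine ⟨u, hadj, ?_⟩
    have h1 := SimpleGraph.dist_le w'
    rw [SimpleGraph.Walk.length_cons, SimpleGraph.dist_comm] at hw
    rw [SimpleGraph.dist_comm] at h1
    have := hG.dist_eq_dist_add_one_of_adj r hadj
    omega

lemma eq_of_adj_of_dist_eq_add_one (hG : G.IsTree) {v w w' : V} (h : G.Adj v w)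
    (hd : G.dist r v = G.dist r w + 1) (h' : G.Adj v w') (hd' : G.dist r v = G.dist r w' + 1) :
    w = w' := by
  have key : ∀ u, G.Adj v u → G.dist r v = G.dist r u + 1 →
      ∃ p : G.Walk r v, p.IsPath ∧ p.penultimate = u := by
    intro u hu hdu
    obtain ⟨p, hp⟩ := hG.connected.exists_walk_length_eq_dist r u
    refine ⟨p.concat hu.symm, ?_, by simp⟩
    refine SimpleGraph.Walk.isPath_of_length_eq_dist _ ?_
    rw [SimpleGraph.Walk.length_concat, hp, hdu]
  obtain ⟨p, hp, rfl⟩ := key w h hd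
  obtain ⟨q, hq, rfl⟩ := key w' h' hd'
  rw [(hG.existsUnique_path r v).unique hp hq]

variable (G r) in
open Classical in
/-- The neighbour of `v` towards the root `r`. -/
noncomputable def treeParent (v : V) : V :=
  if h : ∃ w, G.Adj v w ∧ G.dist r v = G.dist r w + 1 then h.choose else v

lemma adj_treeParent (hG : G.IsTree) {v : V} (hv : v ≠ r) : G.Adj v (treeParent G r v) := by
  rw [treeParent, dif_pos (exists_adj_dist_eq_add_one hG hv)]
  exact (exists_adj_dist_eq_add_one hG hv).choose_spec.1

lemma dist_treeParent (hG : G.IsTree) {v : V} (hv : v ≠ r) :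
    G.dist r v = G.dist r (treeParent G r v) + 1 := by
  rw [treeParent, dif_pos (exists_adj_dist_eq_add_one hG hv)]
  exact (exists_adj_dist_eq_add_one hG hv).choose_spec.2

lemma ne_root_of_dist_eq_add_one {v : V} {k : ℕ} (h : G.dist r v = k + 1) : v ≠ r := by
  rintro rfl
  simp at h

lemma treeParent_eq (hG : G.IsTree) {v w : V} (h : G.Adj v w)
    (hd : G.dist r v = G.dist r w + 1) : treeParent G r v = w := by
  have hv := ne_root_of_dist_eq_add_one hd
  exact eq_of_adj_of_dist_eq_add_one hG (adj_treeParent hG hv) (dist_treeParent hG hv) h hd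

/-- In a rooted tree, one end of every edge is the parent of the other end. -/
lemma treeParent_eq_or_of_adj (hG : G.IsTree) {u v : V} (h : G.Adj u v) :
    (u ≠ r ∧ treeParent G r u = v) ∨ (v ≠ r ∧ treeParent G r v = u) := by
  rcases hG.dist_eq_dist_add_one_of_adj r h with hd | hd
  · exact .inl ⟨ne_root_of_dist_eq_add_one hd, treeParent_eq hG h hd⟩
  · exact .inr ⟨ne_root_of_dist_eq_add_one hd, treeParent_eq hG h.symm hd⟩

lemma finite_neighborSet {D : ℕ} (hdeg : DegreesBoundedBy G D) (v : V) :
    (G.neighborSet v).Finite := by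
  refine Set.encard_lt_top_iff.1 ((hdeg v).trans_lt ?_)
  exact_mod_cast ENat.natCast_lt_top (D + 1)

lemma finite_depthBall (hG : G.IsTree) {D : ℕ} (hdeg : DegreesBoundedBy G D) (n : ℕ) :
    (depthBall G r n).Finite := by
  induction n with
  | zero =>
    refine (Set.finite_singleton r).subset fun v hv => ?_
    have : G.dist r v = 0 := Nat.le_zero.1 hv
    exact (hG.connected.dist_eq_zero_iff.1 this).symm
  | succ n ih =>
    refine (ih.union (ih.biUnion fun v _ => finite_neighborSet hdeg v)).subset fun v hv => ?_
    by_cases h : G.dist r v ≤ n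
    · exact .inl h
    · have hv' : G.dist r v = n + 1 := le_antisymm hv (by omega)
      have hr := ne_root_of_dist_eq_add_one hv'
      have hd := dist_treeParent hG hr
      refine .inr (Set.mem_biUnion (x := treeParent G r v) ?_ (adj_treeParent hG hr).symm)
      change G.dist r (treeParent G r v) ≤ n
      omega

variable (G r) in
/-- The vertices other than the root of depth at most `n`; they correspond to the edges of the
truncated tree. -/
abbrev NonRoot (n : ℕ) : Type _ := {v : V // v ≠ r ∧ G.dist r v ≤ n}

variable (G r) in
/-- A vertex other than the root, as a vertex of the truncated tree. -/
def NonRoot.vertex (n : ℕ) (c : NonRoot G r n) : depthBall G r n := ⟨c.1, c.2.2⟩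

/-- The parent of a vertex other than the root, as a vertex of the truncated tree. -/
noncomputable def NonRoot.parent (hG : G.IsTree) (n : ℕ) (c : NonRoot G r n) : depthBall G r n :=
  ⟨treeParent G r c.1, by
    have := dist_treeParent hG c.2.1
    have := c.2.2
    change G.dist r (treeParent G r c.1) ≤ n
    omega⟩

/-- The edge between a vertex other than the root and its parent. -/
noncomputable def NonRoot.edge (hG : G.IsTree) (n : ℕ) (c : NonRoot G r n) : G.edgeSet :=
  ⟨s(c.1, treeParent G r c.1), adj_treeParent hG c.2.1⟩

lemma NonRoot.vertex_injective (n : ℕ) : Function.Injective (NonRoot.vertex G r n) :=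
  fun _ _ h => Subtype.ext (congrArg (fun v : depthBall G r n => v.1) h)

lemma NonRoot.dist_parent_lt (hG : G.IsTree) (n : ℕ) (c : NonRoot G r n) :
    G.dist r (NonRoot.parent hG n c : V) < G.dist r (NonRoot.vertex G r n c : V) := by
  have := dist_treeParent hG c.2.1
  change G.dist r (treeParent G r c.1) < G.dist r c.1
  omega

lemma NonRoot.parent_ne_vertex (hG : G.IsTree) (n : ℕ) (c : NonRoot G r n) :
    NonRoot.parent hG n c ≠ NonRoot.vertex G r n c := fun h => by
  have := NonRoot.dist_parent_lt hG n c
  rw [h] at this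
  exact this.ne rfl

lemma sym2_treeParent_injective (hG : G.IsTree) {u v : V} (hu : u ≠ r) (hv : v ≠ r)
    (h : s(u, treeParent G r u) = s(v, treeParent G r v)) : u = v := by
  rcases Sym2.eq_iff.1 h with h | ⟨h1, h2⟩
  · exact h.1
  · have d1 := dist_treeParent hG hu
    have d2 := dist_treeParent hG hv
    rw [h2] at d1
    rw [← h1] at d2
    omega

lemma NonRoot.edge_injective (hG : G.IsTree) (n : ℕ) :
    Function.Injective (NonRoot.edge (r := r) hG n) := fun c c' h =>
  Subtype.ext (sym2_treeParent_injective hG c.2.1 c'.2.1 (congrArg Subtype.val h))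

/-- The edges of the truncated tree correspond to its vertices other than the root. -/
lemma numEdges_eq_card (hG : G.IsTree) (n : ℕ) [Fintype (NonRoot G r n)] :
    numEdges G r n = Fintype.card (NonRoot G r n) := by
  have h : (depthSubtree G r n).edgeSet =
      Set.range fun c => s(NonRoot.vertex G r n c, NonRoot.parent hG n c) := by
    ext e
    induction e with
    | _ u v =>
      rw [SimpleGraph.mem_edgeSet, Set.mem_range]
      constructor
      · intro huv
        have huv' : G.Adj u.1 v.1 := huv
        rcases treeParent_eq_or_of_adj (r := r) hG huv' with ⟨h1, h2⟩ | ⟨h1, h2⟩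
        · refine ⟨⟨u.1, h1, u.2⟩, Sym2.eq_iff.2 (.inl ⟨rfl, Subtype.ext h2⟩)⟩
        · refine ⟨⟨v.1, h1, v.2⟩, Sym2.eq_iff.2 (.inr ⟨rfl, Subtype.ext h2⟩)⟩
      · rintro ⟨c, hc⟩
        have hadj : (depthSubtree G r n).Adj (NonRoot.vertex G r n c) (NonRoot.parent hG n c) :=
          adj_treeParent hG c.2.1
        rwa [← SimpleGraph.mem_edgeSet, hc, SimpleGraph.mem_edgeSet] at hadj
  have hinj : Function.Injective fun c : NonRoot G r n =>
      s(NonRoot.vertex G r n c, NonRoot.parent hG n c) := fun c c' hcc => by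
    have := congrArg (Sym2.map Subtype.val) hcc
    simp only [Sym2.map_mk] at this
    exact Subtype.ext (sym2_treeParent_injective hG c.2.1 c'.2.1 this)
  rw [numEdges, h, ← Set.image_univ, Set.ncard_image_of_injective _ hinj, Set.ncard_univ,
    Nat.card_eq_fintype_card]

lemma card_filter_parent_eq_le (hG : G.IsTree) {D : ℕ} (hdeg : DegreesBoundedBy G D) (n : ℕ)
    [Fintype (NonRoot G r n)] [DecidableEq (depthBall G r n)] (v : depthBall G r n) :
    Finset.card {c | NonRoot.parent hG n c = v} ≤ D + 1 := by
  have h1 : ((Finset.card {c | NonRoot.parent hG n c = v} : ℕ) : ℕ∞) ≤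
      (G.neighborSet v.1).encard := by
    rw [← Set.encard_coe_eq_coe_finsetCard, ← Subtype.val_injective.injOn.encard_image]
    refine Set.encard_le_encard ?_
    rintro _ ⟨c, hc, rfl⟩
    simp only [Finset.coe_filter, Finset.mem_univ, true_and, Set.mem_ofPred_eq] at hc
    have := adj_treeParent hG c.2.1
    rw [SimpleGraph.mem_neighborSet, ← hc]
    exact this.symm
  exact_mod_cast h1.trans (hdeg v.1)

lemma card_depthBall_le (n : ℕ) [Fintype (NonRoot G r n)] [Fintype (depthBall G r n)] :
    Fintype.card (depthBall G r n) ≤ Fintype.card (NonRoot G r n) + 1 := by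
  classical
  rw [← Fintype.card_option]
  refine Fintype.card_le_of_injective
    (fun v => if h : v.1 = r then none else some ⟨v.1, h, v.2⟩) fun u v huv => ?_
  by_cases hu : u.1 = r <;> by_cases hv : v.1 = r <;> simp [hu, hv] at huv
  · exact Subtype.ext (hu.trans hv.symm)
  · exact Subtype.ext huv

lemma nonempty_nonRoot (hG : G.IsTree) [Nontrivial V] {n : ℕ} (hn : 1 ≤ n) :
    Nonempty (NonRoot G r n) := by
  obtain ⟨w, hw⟩ := hG.connected.preconnected.exists_adj_of_nontrivial r
  exact ⟨⟨w, hw.ne', by rwa [SimpleGraph.dist_eq_one_iff_adj.2 hw]⟩⟩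

section Regular

variable (hG : G.IsTree) {D : ℕ} (hreg : IsRegularRooted G r D)

include hG hreg

lemma le_encard_children (v : V) :
    (D : ℕ∞) ≤ {w | w ≠ r ∧ treeParent G r w = v}.encard := by
  by_cases hv : v = r
  · subst hv
    rw [← hreg.1]
    refine Set.encard_le_encard fun w hw => ?_
    rcases treeParent_eq_or_of_adj (r := v) hG hw with h | h
    · exact absurd rfl h.1
    · exact h
  · have h := hreg.2 v hv
    have hsub : G.neighborSet v ⊆ insert (treeParent G r v) {w | w ≠ r ∧ treeParent G r w = v} :=
      fun w hw => by
        rcases treeParent_eq_or_of_adj (r := r) hG hw with h | h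
        · exact .inl h.2.symm
        · exact .inr h
    have h2 := (Set.encard_le_encard hsub).trans (Set.encard_insert_le _ _)
    rw [h] at h2
    exact (ENat.add_le_add_iff_right ENat.one_ne_top).1 h2

lemma pow_le_card_sphere (k : ℕ) (hfin : {v | G.dist r v ≤ k}.Finite) :
    D ^ k ≤ {v | G.dist r v = k}.ncard := by
  classical
  induction k with
  | zero =>
    have : {v | G.dist r v = 0} = {r} := by
      ext v
      simp [hG.connected.dist_eq_zero_iff, eq_comm]
    rw [this]
    simp
  | succ k ih =>
    have f0 : {v | G.dist r v ≤ k}.Finite := hfin.subset fun v hv => by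
      simp only [Set.mem_ofPred_eq] at hv ⊢
      omega
    have f1 : {v | G.dist r v = k}.Finite := f0.subset fun v hv => by
      simp only [Set.mem_ofPred_eq] at hv ⊢
      omega
    have f2 : {v | G.dist r v = k + 1}.Finite := hfin.subset fun v hv => by
      simp only [Set.mem_ofPred_eq] at hv ⊢
      omega
    have hmaps : ∀ v ∈ f2.toFinset, treeParent G r v ∈ f1.toFinset := fun v hv => by
      simp only [Set.Finite.mem_toFinset, Set.mem_ofPred_eq] at hv ⊢
      have := dist_treeParent hG (ne_root_of_dist_eq_add_one hv)
      omega
    rw [Set.ncard_eq_toFinset_card _ f2, Finset.card_eq_sum_card_fiberwise hmaps]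
    have hfib : ∀ v ∈ f1.toFinset, D ≤ Finset.card {w ∈ f2.toFinset | treeParent G r w = v} := by
      intro v hv
      simp only [Set.Finite.mem_toFinset, Set.mem_ofPred_eq] at hv
      have hc := le_encard_children hG hreg v
      have : {w | w ≠ r ∧ treeParent G r w = v} =
          (({w ∈ f2.toFinset | treeParent G r w = v} : Finset V) : Set V) := by
        ext w
        simp only [Finset.coe_filter, Set.Finite.mem_toFinset, Set.mem_ofPred_eq]
        refine and_congr_left fun hw => ⟨fun h => ?_, ne_root_of_dist_eq_add_one⟩
        rw [dist_treeParent hG h, hw, hv]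
      rw [this, Set.encard_coe_eq_coe_finsetCard] at hc
      exact_mod_cast hc
    refine le_trans ?_ (Finset.card_nsmul_le_sum _ _ _ hfib)
    rw [← Set.ncard_eq_toFinset_card _ f1, smul_eq_mul, pow_succ]
    exact Nat.mul_le_mul_right _ (ih f0)

lemma sum_pow_le_numEdges (hdeg : DegreesBoundedBy G D) (n : ℕ) :
    ∑ k ∈ Finset.range n, D ^ (k + 1) ≤ numEdges G r n := by
  have hfin := finite_depthBall (r := r) hG hdeg
  have hN : ∀ n, {v | v ≠ r ∧ G.dist r v ≤ n}.Finite := fun n => (hfin n).subset fun v hv => hv.2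
  have hnum : ∀ n, numEdges G r n = {v | v ≠ r ∧ G.dist r v ≤ n}.ncard := fun n => by
    have : Fintype (NonRoot G r n) := (hN n).fintype
    rw [numEdges_eq_card hG, ← Nat.card_eq_fintype_card]
    rfl
  induction n with
  | zero => simp
  | succ n ih =>
    rw [Finset.sum_range_succ]
    have hS := pow_le_card_sphere hG hreg (n + 1) (hfin (n + 1))
    have hunion : {v | v ≠ r ∧ G.dist r v ≤ n + 1} =
        {v | v ≠ r ∧ G.dist r v ≤ n} ∪ {v | G.dist r v = n + 1} := by
      ext v
      simp only [Set.mem_union, Set.mem_ofPred_eq]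
      constructor
      · rintro ⟨h1, h2⟩
        rcases Nat.le_succ_iff.1 h2 with h | h
        · exact .inl ⟨h1, h⟩
        · exact .inr h
      · rintro (h | h)
        · exact ⟨h.1, by omega⟩
        · exact ⟨ne_root_of_dist_eq_add_one h, h.le⟩
    have hdisj : Disjoint {v | v ≠ r ∧ G.dist r v ≤ n} {v | G.dist r v = n + 1} := by
      rw [Set.disjoint_left]
      rintro v ⟨-, h⟩ (h' : G.dist r v = n + 1)
      omega
    have hfS : {v | G.dist r v = n + 1}.Finite :=
      (hfin (n + 1)).subset fun v (hv : G.dist r v = n + 1) => hv.le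
    rw [hnum, hunion, Set.ncard_union_eq hdisj (hN n) hfS, ← hnum]
    exact add_le_add ih hS

end Regular

end RootedTree

section Percolation

variable {V Ω : Type*} {G : SimpleGraph V} {r : V}

/-- The state of the edge between a vertex and its parent: it is kept unless its variable is
`-1`. -/
noncomputable def edgeState (hG : G.IsTree) (X : G.edgeSet → Ω → ℝ) (n : ℕ) (ω : Ω)
    (c : NonRoot G r n) : Bool := decide (X (NonRoot.edge hG n c) ω ≠ -1)

lemma componentCount_eq_sum_topIndicator (hG : G.IsTree) (X : G.edgeSet → Ω → ℝ) (n : ℕ)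
    [Fintype (NonRoot G r n)] [Fintype (depthBall G r n)] [DecidableEq (depthBall G r n)] (ω : Ω) :
    componentCount G r X n ω =
      ∑ v, topIndicator (NonRoot.vertex G r n) (NonRoot.parent hG n) v (edgeState hG X n ω) := by
  refine numEdgeComponents_eq_sum_topIndicator (depth := fun v : depthBall G r n => G.dist r v)
    (NonRoot.dist_parent_lt hG n) (fun u v => ?_) (NonRoot.vertex_injective n)
  have hper : ∀ a b : V, (percolated G fun e => X e ω).Adj a b ↔
      ∃ h : G.Adj a b, X ⟨s(a, b), h⟩ ω ≠ -1 := fun a b => by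
    rw [percolated, SimpleGraph.deleteEdges_adj]
    simp only [Set.mem_ofPred_eq, not_exists]
    exact ⟨fun h => ⟨h.1, h.2 h.1⟩, fun ⟨h, h'⟩ => ⟨h, fun _ => h'⟩⟩
  rw [SimpleGraph.comap_adj]
  simp only [Function.Embedding.subtype_apply, edgeState, decide_eq_true_eq]
  constructor
  · intro h
    obtain ⟨huv, hx⟩ := (hper _ _).1 h
    rcases treeParent_eq_or_of_adj (r := r) hG huv with ⟨h1, h2⟩ | ⟨h1, h2⟩
    · refine ⟨⟨u.1, h1, u.2⟩, ?_, .inl ⟨rfl, Subtype.ext h2.symm⟩⟩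
      convert hx using 3
      exact Subtype.ext (Sym2.eq_iff.2 (.inl ⟨rfl, h2⟩))
    · refine ⟨⟨v.1, h1, v.2⟩, ?_, .inr ⟨rfl, Subtype.ext h2.symm⟩⟩
      convert hx using 3
      exact Subtype.ext (Sym2.eq_iff.2 (.inr ⟨rfl, h2⟩))
  · have key : ∀ c : NonRoot G r n, X (NonRoot.edge hG n c) ω ≠ -1 →
        (percolated G fun e => X e ω).Adj (NonRoot.vertex G r n c).1 (NonRoot.parent hG n c).1 :=
      fun c hc => (hper _ _).2 ⟨adj_treeParent hG c.2.1, hc⟩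
    rintro ⟨c, hc, ⟨rfl, rfl⟩ | ⟨rfl, rfl⟩⟩
    · exact key c hc
    · exact (key c hc).symm

variable [MeasurableSpace Ω] {P : Measure Ω} {X : G.edgeSet → Ω → ℝ} {p : ℝ}

lemma measurable_decide_ne_neg_one : Measurable fun t : ℝ => decide (t ≠ -1) :=
  measurable_to_bool (by
    have : (fun t : ℝ => decide (t ≠ -1)) ⁻¹' {true} = {-1}ᶜ := by
      ext t
      simp
    rw [this]
    exact (measurableSet_singleton _).compl)

lemma measurable_edgeState (hG : G.IsTree) (hX : IsRademacherEdgeFamily G X p P) (n : ℕ)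
    (c : NonRoot G r n) : Measurable fun ω => edgeState hG X n ω c :=
  measurable_decide_ne_neg_one.comp (hX.measurable _)

lemma normalized_comp {Ω' : Type*} [MeasurableSpace Ω'] {Y : Ω → Ω'} (hY : Measurable Y)
    {F : Ω' → ℝ} (hF : Measurable F) (ω : Ω) :
    normalized (fun ω => F (Y ω)) P ω = normalized F (P.map Y) (Y ω) := by
  rw [normalized, normalized, integral_map hY.aemeasurable hF.aestronglyMeasurable,
    variance_map hF.aemeasurable hY.aemeasurable]
  rfl

lemma kolmogorovDist_le {Ω' : Type*} [MeasurableSpace Ω'] {Q : Measure Ω'}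
    {F : Ω → ℝ} {N : Ω' → ℝ} (hN : HasLaw N (gaussianReal 0 1) Q) {C : ℝ}
    (h : ∀ x, |P.real {ω | F ω ≤ x} - stdCdf x| ≤ C) : kolmogorovDist F P N Q ≤ C := by
  refine ciSup_le fun x => ?_
  have hQ : Q.real {ω | N ω ≤ x} = stdCdf x := by
    rw [stdCdf, measureReal_def, measureReal_def, ← hN.map_eq,
      Measure.map_apply_of_aemeasurable hN.aemeasurable measurableSet_Iic]
    rfl
  rw [hQ]
  exact h x

variable [IsProbabilityMeasure P]

lemma map_edgeState_eq_pi (hG : G.IsTree) (hX : IsRademacherEdgeFamily G X p P) (n : ℕ)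
    [Fintype (NonRoot G r n)] :
    P.map (edgeState hG X n) =
      Measure.pi fun c : NonRoot G r n => P.map fun ω => edgeState hG X n ω c := by
  have h := (hX.indep.precomp (NonRoot.edge_injective (r := r) hG n)).comp
    (fun _ t => decide (t ≠ -1)) fun _ => measurable_decide_ne_neg_one
  exact (iIndepFun_iff_map_fun_eq_pi_map
    fun c => (measurable_edgeState hG hX n c).aemeasurable).1 h

lemma map_edgeState_real_true (hG : G.IsTree) (hX : IsRademacherEdgeFamily G X p P) (n : ℕ)
    (c : NonRoot G r n) : (P.map fun ω => edgeState hG X n ω c).real {true} = p := by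
  rw [measureReal_def, Measure.map_apply (measurable_edgeState hG hX n c)
    (Set.toFinite _).measurableSet]
  have hm : MeasurableSet {ω | X (NonRoot.edge hG n c) ω = -1} :=
    hX.measurable _ (measurableSet_singleton (-1))
  have h : (fun ω => edgeState hG X n ω c) ⁻¹' {true} =
      {ω | X (NonRoot.edge hG n c) ω = -1}ᶜ := by
    ext ω
    simp [edgeState]
  rw [h, ← measureReal_def, probReal_compl_eq_one_sub hm, hX.prob_neg_one]
  ring

/-- The Berry-Esseen bound for the number of clusters in terms of the number of edges. -/
theorem exists_kolmogorovDist_componentCount_le [Nontrivial V] (hG : G.IsTree) {D : ℕ}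
    (hdeg : DegreesBoundedBy G D) (hp0 : 0 < p) (hp1 : p < 1)
    (hX : IsRademacherEdgeFamily G X p P) {Ω' : Type*} [MeasurableSpace Ω'] {Q : Measure Ω'}
    {N : Ω' → ℝ} (hN : HasLaw N (gaussianReal 0 1) Q) :
    ∃ C : ℝ, 0 < C ∧ ∀ n : ℕ, 1 ≤ n → 1 ≤ numEdges G r n ∧
      kolmogorovDist (normalized (componentCount G r X n) P) P N Q ≤ C / √(numEdges G r n) := by
  classical
  obtain ⟨C, hC, hbound⟩ := exists_abs_measureReal_topIndicator_le (D + 1) hp0 hp1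
  refine ⟨C, hC, fun n hn => ?_⟩
  have hfin := finite_depthBall (r := r) hG hdeg n
  have : Fintype (depthBall G r n) := hfin.fintype
  have : Fintype (NonRoot G r n) := (hfin.subset fun v (hv : v ≠ r ∧ _) => hv.2).fintype
  have : Nonempty (NonRoot G r n) := nonempty_nonRoot hG hn
  have hcard : 1 ≤ Fintype.card (NonRoot G r n) := Fintype.card_pos
  rw [numEdges_eq_card hG]
  refine ⟨hcard, kolmogorovDist_le hN fun x => ?_⟩
  have : ∀ c : NonRoot G r n, IsProbabilityMeasure (P.map fun ω => edgeState hG X n ω c) :=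
    fun c => Measure.isProbabilityMeasure_map (measurable_edgeState hG hX n c).aemeasurable
  have hmeas : Measurable (edgeState (r := r) hG X n) :=
    measurable_pi_iff.2 (measurable_edgeState hG hX n)
  have h := hbound (NonRoot G r n) (depthBall G r n) (NonRoot.vertex G r n) (NonRoot.parent hG n)
    (NonRoot.vertex_injective n) (NonRoot.parent_ne_vertex hG n)
    (card_filter_parent_eq_le hG hdeg n) ((card_depthBall_le n).trans (by omega))
    (fun c => P.map fun ω => edgeState hG X n ω c) (map_edgeState_real_true hG hX n) x
  rw [← map_edgeState_eq_pi hG hX n] at h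
  convert h using 3
  rw [measureReal_def, measureReal_def, Measure.map_apply hmeas (Set.toFinite _).measurableSet]
  congr 2
  ext ω
  have e : componentCount G r X n = fun ω => ∑ v, topIndicator (NonRoot.vertex G r n)
      (NonRoot.parent hG n) v (edgeState hG X n ω) :=
    funext (componentCount_eq_sum_topIndicator hG X n)
  rw [e, Set.mem_preimage, Set.mem_ofPred_eq, Set.mem_ofPred_eq,
    normalized_comp hmeas (measurable_of_finite fun y => ∑ v, topIndicator
      (NonRoot.vertex G r n) (NonRoot.parent hG n) v y)]

end Percolation

theorem theorem1p4 {V : Type*} [Infinite V] (G : SimpleGraph V) (hG : G.IsTree) (r : V)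
    (D : ℕ) (hD : 1 ≤ D) (hdeg : DegreesBoundedBy G D)
    (p : ℝ) (hp0 : 0 < p) (hp1 : p < 1)
    {Ω : Type*} [MeasurableSpace Ω] (P : Measure Ω) [IsProbabilityMeasure P]
    (X : G.edgeSet → Ω → ℝ) (hX : IsRademacherEdgeFamily G X p P)
    {Ω' : Type*} [MeasurableSpace Ω'] (Q : Measure Ω') [IsProbabilityMeasure Q]
    (N : Ω' → ℝ) (hN : HasLaw N (gaussianReal 0 1) Q) :
    ((fun n : ℕ => kolmogorovDist (normalized (componentCount G r X n) P) P N Q)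
        =O[atTop] fun n : ℕ => (numEdges G r n : ℝ) ^ (-(1 / 2) : ℝ)) ∧
    (IsRegularRooted G r D →
      (D = 1 →
        (fun n : ℕ => kolmogorovDist (normalized (componentCount G r X n) P) P N Q)
          =O[atTop] fun n : ℕ => (n : ℝ) ^ (-(1 / 2) : ℝ)) ∧
      (2 ≤ D →
        (fun n : ℕ => kolmogorovDist (normalized (componentCount G r X n) P) P N Q)
          =O[atTop] fun n : ℕ => (D : ℝ) ^ (-(n : ℝ) / 2))) := by
  obtain ⟨C, hC, hbound⟩ := exists_kolmogorovDist_componentCount_le (r := r) hG hdeg hp0 hp1 hX hN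
  have rpow_eq : ∀ t : ℝ, 0 < t → t ^ (-(1 / 2) : ℝ) = 1 / √t := fun t ht => by
    rw [Real.rpow_neg ht.le, ← Real.sqrt_eq_rpow, one_div]
  have key : ∀ m : ℕ → ℝ, (∀ n, 1 ≤ n → 0 < m n ∧ m n ≤ numEdges G r n) →
      (fun n : ℕ => kolmogorovDist (normalized (componentCount G r X n) P) P N Q)
        =O[atTop] fun n : ℕ => m n ^ (-(1 / 2) : ℝ) := by
    intro m hm
    refine IsBigO.of_bound C ?_
    filter_upwards [eventually_ge_atTop 1] with n hn
    obtain ⟨h0, h1⟩ := hm n hn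
    have hK : 0 ≤ kolmogorovDist (normalized (componentCount G r X n) P) P N Q :=
      Real.iSup_nonneg fun _ => abs_nonneg _
    rw [Real.norm_of_nonneg hK, Real.norm_of_nonneg (Real.rpow_nonneg h0.le _), rpow_eq _ h0,
      mul_one_div]
    refine (hbound n hn).2.trans ?_
    have := Real.sqrt_pos.2 h0
    gcongr
  refine ⟨key _ fun n hn => ⟨by exact_mod_cast (hbound n hn).1, le_rfl⟩, fun hreg => ⟨?_, ?_⟩⟩
  · rintro rfl
    refine key _ fun n hn => ⟨by exact_mod_cast hn, ?_⟩
    have := sum_pow_le_numEdges hG hreg hdeg n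
    simp only [one_pow, Finset.sum_const, Finset.card_range, smul_eq_mul, mul_one] at this
    exact_mod_cast this
  · intro _
    have hD0 : (0 : ℝ) < D := by exact_mod_cast hD
    have e : (fun n : ℕ => (D : ℝ) ^ (-(n : ℝ) / 2)) =
        fun n : ℕ => ((D : ℝ) ^ n) ^ (-(1 / 2) : ℝ) := by
      funext n
      rw [← Real.rpow_natCast, ← Real.rpow_mul hD0.le]
      congr 1
      ring
    rw [e]
    refine key _ fun n hn => ⟨by positivity, ?_⟩
    obtain ⟨k, rfl⟩ : ∃ k, n = k + 1 := ⟨n - 1, by omega⟩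
    have h1 := sum_pow_le_numEdges hG hreg hdeg (k + 1)
    have h2 : D ^ (k + 1) ≤ ∑ j ∈ Finset.range (k + 1), D ^ (j + 1) :=
      Finset.single_le_sum (f := fun j => D ^ (j + 1)) (fun _ _ => Nat.zero_le _)
        (Finset.self_mem_range_succ k)
    exact_mod_cast h2.trans h1
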